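/- All graphs are finite and simple. For a graph $G$, write $c(G)$ for the number of its connected components. For a real number $t\ge 0$, $G$ is $t$-tough if $|S|\ge t\cdot c(G-S)$ for every $S\subseteq V(G)$ with $c(G-S)\ge 2$. Let $\sigma_2(G)=\min\{d_G(u)+d_G(v) : u,v\in V(G) \text{ distinct and nonadjacent}\}$ if $G$ is not complete, and $\sigma_2(G)=\infty$ if $G$ is complete. **Theorem.** Let $t\ge 0$ be a real number and let $G$ be a $t$-tough graph on $n\ge 3$ vertices. If $\sigma_2(G)>\frac{2n}{t+1}+t-2$, then $G$ is hamiltonian, that is, $G$ has a cycle through all of its vertices. -/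

import Mathlib

namespace SimpleGraph

/-- `G` is `t`-tough: `|S| ≥ t · c(G - S)` for every vertex set `S` with `c(G - S) ≥ 2`, where
`c(G - S)` is the number of connected components of the subgraph induced by the complement
of `S`. -/
def IsTough {V : Type*} [Fintype V] (G : SimpleGraph V) (t : ℝ) : Prop :=
  ∀ S : Set V, 2 ≤ Nat.card (G.induce Sᶜ).ConnectedComponent →
    t * (Nat.card (G.induce Sᶜ).ConnectedComponent : ℝ) ≤ (S.ncard : ℝ)

/-- `σ₂(G)`: the minimum of `d(u) + d(v)` over all pairs of distinct nonadjacent vertices `u`, `v`,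
with the value `∞` (the empty infimum) when `G` is complete. -/
noncomputable def sigmaTwo {V : Type*} [Fintype V] (G : SimpleGraph V) [DecidableRel G.Adj] :
    EReal :=
  ⨅ (u : V) (v : V) (_ : u ≠ v) (_ : ¬ G.Adj u v), ((G.degree u + G.degree v : ℕ) : EReal)

end SimpleGraph

/-!
# A degree sum condition for hamiltonicity of tough graphs

For `t < 1` the degree condition says `d(u) + d(v) ≥ n`, which makes `G` a `1`-tough graph
(`isTough_one_of_card_le_degree_add`) and reduces the claim to `t = 1`. So let `t ≥ 1` and suppose
that `G` is not hamiltonian.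

Among all cycles `C` of `G`, an edge counting as a cycle of length two, take one that minimizes the
sum of `(n + 1) ^ |K(y)|` over the vertices `y` off `C`, where `K(y)` is the component of `y` in
`G - C`. Fix a component `H` of `G - C`, of
order `m`. By `potential_lt`, no cycle can meet `H` and leave the vertices of `C` that it omits in
components of order less than `m`. Let `v_1, …, v_k` be the vertices of `C` with a neighbour in `H`,
and `u_i` the successor of `v_i` on `C`.

* Behind each `v_i` take the shortest stretch of `C` that has, together with the components of
  `G - C` attached to it, at least `m` vertices. An edge between two of these sets would yield a
  detour through `H` leaving the omitted vertices of `C` in components of order less than `m`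
  (`not_linked`). So these `k` sets and `H` are separated from each other, and toughness gives
  `(t + m)(k + 1) ≤ n` (`add_mul_le`). Separating `H` from the rest gives `2t ≤ k`. In particular
  the `u_i` are independent and no vertex off `C` has two neighbours among them.
* For fixed `p`, let `Z_p` be the set of vertices `z` of `C` whose successor is adjacent to `u_p` and
  to some `u_q` that comes after `u_p` when `C` is traversed from `z`. If two vertices of
  `Z_p ∪ {u_p}` were adjacent, then `C` could be reordered to a path through all its vertices between
  two of the `v_i` (`not_crossing`, `not_crossing_four`), which closes up through `H`. So
  `Z_p ∪ {u_p}` is independent, and toughness gives `(t + 1)(|Z_p| + 2) + m - 1 ≤ n`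
  (`cross_card_le`).
* The successor of a vertex `z` of `C` has at most one more neighbour among the `u_i` than there are
  `p` with `z ∈ Z_p`, as only the last of these neighbours, seen from `z`, is not counted. Summing up,
  `∑ d(u_p) ≤ n - m - k + ∑ |Z_p|` (`sum_degree_le`).

A vertex `x` of `H` has degree at most `k + m - 1` and is not adjacent to any `u_p`. Adding up the
degree condition for the pairs `x, u_p` contradicts these estimates (`arithmetic_contradiction`).
-/

namespace SimpleGraph

section

variable {V : Type*} {G : SimpleGraph V}

/-! ### Paths and cycles as vertex lists -/

/-- `l` lists, in order, the vertices of a path of `G` from `a` to `b`. -/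
structure IsPathList (G : SimpleGraph V) (a b : V) (l : List V) : Prop where
  chain : l.IsChain G.Adj
  nodup : l.Nodup
  head : l.head? = some a
  last : l.getLast? = some b

/-- `l` lists the vertices of a cycle of `G` in cyclic order. An edge, traversed back and forth,
counts as a cycle of length two. -/
def IsCycleList (G : SimpleGraph V) (l : List V) : Prop :=
  2 ≤ l.length ∧ ∃ a b, G.IsPathList a b l ∧ G.Adj b a

namespace IsPathList

variable {a b a' b' : V} {l l' : List V}

lemma singleton (G : SimpleGraph V) (a : V) : G.IsPathList a a [a] :=
  ⟨List.isChain_singleton _, List.nodup_singleton _, rfl, rfl⟩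

lemma head_mem (h : G.IsPathList a b l) : a ∈ l := List.mem_of_head? h.head

lemma last_mem (h : G.IsPathList a b l) : b ∈ l := List.mem_of_getLast? h.last

lemma ne_nil (h : G.IsPathList a b l) : l ≠ [] := List.ne_nil_of_mem h.head_mem

lemma reverse (h : G.IsPathList a b l) : G.IsPathList b a l.reverse :=
  ⟨by simpa [List.isChain_reverse, G.adj_comm] using h.chain, by simpa using h.nodup,
    by simpa using h.last, by simpa using h.head⟩

lemma append (h : G.IsPathList a b l) (h' : G.IsPathList a' b' l') (hadj : G.Adj b a')
    (hd : ∀ x ∈ l, x ∉ l') : G.IsPathList a b' (l ++ l') := by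
  refine ⟨?_, ?_, ?_, ?_⟩
  · rw [List.isChain_append]
    refine ⟨h.chain, h'.chain, ?_⟩
    simpa [h.last, h'.head] using hadj
  · rw [List.nodup_append]
    exact ⟨h.nodup, h'.nodup, fun x hx y hy hxy => hd x hx (hxy ▸ hy)⟩
  · simp [List.head?_append, h.head]
  · simp [List.getLast?_append, h'.last]

lemma isCycleList (h : G.IsPathList a b l) (hadj : G.Adj b a) : G.IsCycleList l := by
  refine ⟨?_, a, b, h, hadj⟩
  by_contra hlt
  obtain ⟨x, rfl⟩ : ∃ x, l = [x] := by
    rw [← List.length_eq_one_iff]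
    have := List.length_pos_iff.2 h.ne_nil
    omega
  have h1 := h.head
  have h2 := h.last
  simp only [List.head?_cons, List.getLast?_singleton, Option.some.injEq] at h1 h2
  subst h1 h2
  exact G.irrefl hadj

end IsPathList

lemma Walk.IsPath.isPathList_support {a b : V} {p : G.Walk a b} (hp : p.IsPath) :
    G.IsPathList a b p.support :=
  ⟨p.isChain_adj_support, hp.support_nodup, by simp [List.head?_eq_some_head p.support_ne_nil],
    by simp [List.getLast?_eq_some_getLast p.support_ne_nil]⟩

/-- A cyclic list through all of at least three vertices makes the graph hamiltonian. -/
lemma IsCycleList.isHamiltonian [Fintype V] [DecidableEq V] {l : List V} (hl : G.IsCycleList l)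
    (hn : 3 ≤ Fintype.card V) (hall : ∀ v, v ∈ l) : G.IsHamiltonian := by
  obtain ⟨-, a, b, hp, hadj⟩ := hl
  have hlen : l.length = Fintype.card V := by
    rw [← List.toFinset_card_of_nodup hp.nodup, ← Finset.card_univ]
    congr 1
    ext v
    simp [hall v]
  have key : ∀ (x y : V) (p : G.Walk x y), p.support = l → x = a → y = b → G.IsHamiltonian := by
    rintro x y p hsupp rfl rfl -
    have hpath : p.IsPath := Walk.IsPath.mk' (hsupp ▸ hp.nodup)
    have hplen : p.length + 1 = Fintype.card V := by rw [← Walk.length_support, hsupp, hlen]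
    refine ⟨y, .cons hadj p, ?_⟩
    rw [Walk.isHamiltonianCycle_iff_isCycle_and_length_eq, Walk.cons_isCycle_iff]
    refine ⟨⟨hpath, fun hmem => ?_⟩, by simpa using hplen⟩
    have := hpath.length_eq_one_of_mem_edges (Sym2.eq_swap ▸ hmem)
    omega
  refine key _ _ (Walk.ofSupport l hp.ne_nil hp.chain) (Walk.support_ofSupport _ _) ?_ ?_
  · have := hp.head
    rw [List.head?_eq_some_head hp.ne_nil] at this
    simpa using this
  · have := hp.last
    rw [List.getLast?_eq_some_getLast hp.ne_nil] at this
    simpa using this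

/-! ### Periodic enumerations of cycles -/

/-- `c` runs periodically through the `N` vertices of a cycle of `G`. -/
structure IsCyclicEnum (G : SimpleGraph V) (c : ℕ → V) (N : ℕ) : Prop where
  two_le : 2 ≤ N
  add_period : ∀ i, c (i + N) = c i
  inj : ∀ i j, i < N → j < N → c i = c j → i = j
  adj : ∀ i, G.Adj (c i) (c (i + 1))

/-- Every cyclic list is run through by a periodic enumeration. -/
lemma IsCycleList.exists_enum {l : List V} (hl : G.IsCycleList l) :
    ∃ c : ℕ → V, G.IsCyclicEnum c l.length ∧ ∀ v, v ∈ l ↔ ∃ i < l.length, c i = v := by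
  obtain ⟨h2, a, b, hp, hadj⟩ := hl
  have hpos : 0 < l.length := by omega
  refine ⟨fun i => l[i % l.length]'(Nat.mod_lt _ hpos), ⟨h2, ?_, ?_, ?_⟩, ?_⟩
  · intro i; simp
  · intro i j hi hj hij
    simp only [Nat.mod_eq_of_lt hi, Nat.mod_eq_of_lt hj] at hij
    exact (hp.nodup.getElem_inj_iff).1 hij
  · intro i
    have hlt := Nat.mod_lt i hpos
    rcases Nat.lt_or_ge (i % l.length + 1) l.length with h | h
    · have e : (i + 1) % l.length = i % l.length + 1 := by
        rw [Nat.add_mod, Nat.mod_eq_of_lt (show 1 < l.length by omega), Nat.mod_eq_of_lt h]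
      simp only [e]
      exact hp.chain.getElem _ _
    · have e1 : i % l.length = l.length - 1 := by omega
      have e : (i + 1) % l.length = 0 := by
        rw [Nat.add_mod, Nat.mod_eq_of_lt (show 1 < l.length by omega), e1]
        rw [Nat.sub_add_cancel hpos, Nat.mod_self]
      simp only [e, e1]
      have h1 := hp.head
      have h2 := hp.last
      rw [List.head?_eq_getElem?, List.getElem?_eq_getElem hpos] at h1
      rw [List.getLast?_eq_getElem?, List.getElem?_eq_getElem (by omega)] at h2
      simp only [Option.some.injEq] at h1 h2
      rwa [h1, h2]
  · intro v
    rw [List.mem_iff_getElem]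
    constructor
    · rintro ⟨i, hi, rfl⟩
      exact ⟨i, hi, by simp [Nat.mod_eq_of_lt hi]⟩
    · rintro ⟨i, hi, rfl⟩
      exact ⟨i, hi, by simp [Nat.mod_eq_of_lt hi]⟩

/-- The list `c s, c (s + 1), …, c (e - 1)`. -/
def arc (c : ℕ → V) (s e : ℕ) : List V := (List.range' s (e - s)).map c

lemma mem_arc {c : ℕ → V} {s e : ℕ} {v : V} : v ∈ arc c s e ↔ ∃ i, s ≤ i ∧ i < e ∧ c i = v := by
  simp only [arc, List.mem_map, List.mem_range'_1]
  constructor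
  · rintro ⟨i, hi, rfl⟩; exact ⟨i, hi.1, by omega, rfl⟩
  · rintro ⟨i, h1, h2, rfl⟩; exact ⟨i, by omega, rfl⟩

namespace IsCyclicEnum

variable {c : ℕ → V} {N : ℕ}

lemma apply_mod (h : G.IsCyclicEnum c N) (i : ℕ) : c (i % N) = c i :=
  Function.Periodic.map_mod_nat h.add_period i

lemma modEq_of_apply_eq (h : G.IsCyclicEnum c N) {i j : ℕ} (hij : c i = c j) : i ≡ j [MOD N] := by
  have hN : 0 < N := by have := h.two_le; omega
  exact h.inj _ _ (Nat.mod_lt _ hN) (Nat.mod_lt _ hN) (by rw [h.apply_mod, h.apply_mod, hij])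

/-- Walking back from a common vertex. -/
lemma apply_eq_apply_sub (h : G.IsCyclicEnum c N) {i j a b : ℕ} (he : c (i + a) = c (j + b))
    (hab : a ≤ b) : c i = c (j + (b - a)) := by
  have h1 : i ≡ j + (b - a) [MOD N] := by
    apply Nat.ModEq.add_right_cancel' a
    rw [add_assoc, Nat.sub_add_cancel hab]
    exact h.modEq_of_apply_eq he
  rw [← h.apply_mod i, ← h.apply_mod (j + (b - a))]
  exact congrArg c h1

/-- Two indices less than a full turn apart that carry the same vertex are equal. -/
lemma eq_of_apply_eq (h : G.IsCyclicEnum c N) {i j s : ℕ} (hi : s ≤ i) (hi' : i < s + N)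
    (hj : s ≤ j) (hj' : j < s + N) (hij : c i = c j) : i = j := by
  have h2 : (i - s) ≡ (j - s) [MOD N] := by
    apply Nat.ModEq.add_right_cancel' s
    rw [Nat.sub_add_cancel hi, Nat.sub_add_cancel hj]
    exact h.modEq_of_apply_eq hij
  have := h2.eq_of_lt_of_lt (by omega) (by omega)
  omega

lemma isPathList_arc (h : G.IsCyclicEnum c N) {s e : ℕ} (hse : s < e) (heN : e ≤ s + N) :
    G.IsPathList (c s) (c (e - 1)) (arc c s e) := by
  refine ⟨?_, ?_, ?_, ?_⟩
  · rw [arc, List.isChain_map, List.isChain_iff_getElem]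
    intro i hi
    simp only [List.getElem_range', one_mul]
    rw [← add_assoc]
    exact h.adj _
  · refine List.Nodup.map_on ?_ List.nodup_range'
    intro i hi j hj hij
    rw [List.mem_range'_1] at hi hj
    exact h.eq_of_apply_eq (s := s) hi.1 (by omega) hj.1 (by omega) hij
  · simp [arc, List.head?_range', show ¬ e - s = 0 by omega]
  · simp [arc, List.getLast?_range', show ¬ e - s = 0 by omega]
    congr 1; omega

/-- Arcs over disjoint index ranges within one turn have no common vertex. -/
lemma arc_disjoint (h : G.IsCyclicEnum c N) {s s₁ e₁ s₂ e₂ : ℕ} (h1 : s ≤ s₁) (h2 : s ≤ s₂)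
    (h3 : e₁ ≤ s + N) (h4 : e₂ ≤ s + N) (hd : e₁ ≤ s₂ ∨ e₂ ≤ s₁) :
    ∀ x ∈ arc c s₁ e₁, x ∉ arc c s₂ e₂ := by
  intro x hx hx'
  obtain ⟨i, hi, hi', rfl⟩ := mem_arc.1 hx
  obtain ⟨j, hj, hj', hij⟩ := mem_arc.1 hx'
  have := h.eq_of_apply_eq (s := s) (by omega) (by omega) (by omega) (by omega) hij
  omega

end IsCyclicEnum

end

section

variable {V : Type*} {G : SimpleGraph V}

/-! ### Components off a cycle and an extremal cycle -/

/-- The graph `G - X`, kept on the vertex type of `G`: the vertices of `X` become isolated. -/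
def avoid (G : SimpleGraph V) (X : Finset V) : SimpleGraph V where
  Adj a b := G.Adj a b ∧ a ∉ X ∧ b ∉ X
  symm := ⟨fun _ _ h => ⟨h.1.symm, h.2.2, h.2.1⟩⟩
  loopless := ⟨fun _ h => G.irrefl h.1⟩

lemma avoid_le (G : SimpleGraph V) (X : Finset V) : G.avoid X ≤ G := fun _ _ h => h.1

open Classical in
/-- The vertex set of the component of `G - X` that contains `y` (just `{y}` if `y ∈ X`). -/
noncomputable def comp [Fintype V] (G : SimpleGraph V) (X : Finset V) (y : V) : Finset V :=
  Finset.univ.filter fun w => (G.avoid X).Reachable y w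

section comp

variable [Fintype V] {X X' : Finset V} {x y z : V}

lemma mem_comp : z ∈ G.comp X y ↔ (G.avoid X).Reachable y z := by simp [comp]

lemma self_mem_comp : y ∈ G.comp X y := mem_comp.2 (Reachable.refl y)

lemma comp_eq_of_mem (h : z ∈ G.comp X y) : G.comp X z = G.comp X y := by
  ext w
  rw [mem_comp] at *
  rw [mem_comp]
  exact ⟨fun h' => h.trans h', fun h' => h.symm.trans h'⟩

lemma mem_comp_of_adj (hz : z ∈ G.comp X y) (ha : G.Adj z x) (hzX : z ∉ X) (hxX : x ∉ X) :
    x ∈ G.comp X y := by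
  rw [mem_comp] at *
  exact hz.trans (Adj.reachable (G := G.avoid X) ⟨ha, hzX, hxX⟩)

/-- A vertex set that is closed under taking neighbours in `G - X` is a union of components. -/
lemma comp_subset {T : Finset V} (hy : y ∈ T)
    (hT : ∀ a ∈ T, ∀ b, G.Adj a b → a ∉ X → b ∉ X → b ∈ T) : G.comp X y ⊆ T := by
  intro z hz
  rw [mem_comp] at hz
  obtain ⟨p⟩ := hz
  induction p with
  | nil => exact hy
  | cons h p ih => exact ih (hT _ hy _ h.1 h.2.1 h.2.2)

lemma notMem_of_mem_comp (hy : y ∉ X) (hz : z ∈ G.comp X y) : z ∉ X := by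
  classical
  have : G.comp X y ⊆ Finset.univ.filter (· ∉ X) :=
    comp_subset (by simpa using hy) (fun a _ b _ _ hb => by simpa using hb)
  simpa using this hz

/-- A sum over the vertices off `X` that is dominated by the order of the largest component. -/
noncomputable def potential (G : SimpleGraph V) (X : Finset V) : ℕ :=
  open Classical in ∑ y ∈ Finset.univ.filter (· ∉ X), (Fintype.card V + 1) ^ (G.comp X y).card

/-- The potential drops if `X` is replaced by a set `X'` that meets a component `H` of `G - X`,
provided that each vertex of `X` outside `X'` lies in a component of `G - X'` smaller than `H`:
components of `G - X'` that avoid `X` are contained in components of `G - X`, and the small ones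
are outweighed by a single vertex of `H`. -/
lemma potential_lt (hx : x ∉ X) (hmeet : ∃ y ∈ G.comp X x, y ∈ X')
    (hsmall : ∀ y ∈ X, y ∉ X' → (G.comp X' y).card < (G.comp X x).card) :
    G.potential X' < G.potential X := by
  classical
  set m := (G.comp X x).card with hm
  set n := Fintype.card V with hn
  have hmpos : 0 < m := Finset.card_pos.2 ⟨x, self_mem_comp⟩
  have hclass : ∀ y, y ∉ X' → (G.comp X' y).card < m ∨
      (y ∉ X ∧ y ∉ G.comp X x ∧ (G.comp X' y).card ≤ (G.comp X y).card) := by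
    intro y hy
    by_cases hmX : ∃ z ∈ G.comp X' y, z ∈ X
    · obtain ⟨z, hz, hzX⟩ := hmX
      left
      rw [← comp_eq_of_mem hz]
      exact hsmall z hzX (notMem_of_mem_comp hy hz)
    · push Not at hmX
      have hyX : y ∉ X := hmX y self_mem_comp
      have hsub : G.comp X' y ⊆ G.comp X y := by
        have : G.comp X' y ⊆ (G.comp X y) ∩ G.comp X' y :=
          comp_subset (by simp [self_mem_comp]) (by
            intro a ha b hab ha' hb'
            rw [Finset.mem_inter] at ha ⊢
            have hb := mem_comp_of_adj ha.2 hab ha' hb'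
            exact ⟨mem_comp_of_adj ha.1 hab (hmX a ha.2) (hmX b hb), hb⟩)
        exact this.trans Finset.inter_subset_left
      by_cases hyH : y ∈ G.comp X x
      · left
        obtain ⟨z, hzH, hzX'⟩ := hmeet
        rw [comp_eq_of_mem hyH] at hsub
        refine Finset.card_lt_card ⟨hsub, fun h => ?_⟩
        exact notMem_of_mem_comp hy (h hzH) hzX'
      · exact Or.inr ⟨hyX, hyH, Finset.card_le_card hsub⟩
  calc G.potential X'
      ≤ ∑ y ∈ Finset.univ.filter (· ∉ X'), ((n + 1) ^ (m - 1) +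
          if y ∉ X ∧ y ∉ G.comp X x then (n + 1) ^ (G.comp X y).card else 0) := by
        refine Finset.sum_le_sum fun y hy => ?_
        rcases hclass y (by simpa using hy) with h | ⟨h1, h2, h3⟩
        · exact (Nat.pow_le_pow_right (by omega) (by omega)).trans (Nat.le_add_right _ _)
        · rw [if_pos ⟨h1, h2⟩]
          exact (Nat.pow_le_pow_right (by omega) h3).trans (Nat.le_add_left _ _)
    _ ≤ ∑ y : V, ((n + 1) ^ (m - 1) +
          if y ∉ X ∧ y ∉ G.comp X x then (n + 1) ^ (G.comp X y).card else 0) :=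
        Finset.sum_le_sum_of_subset (Finset.subset_univ _)
    _ = n * (n + 1) ^ (m - 1) +
          ∑ y ∈ Finset.univ.filter (fun y => y ∉ X ∧ y ∉ G.comp X x),
            (n + 1) ^ (G.comp X y).card := by
        rw [Finset.sum_add_distrib, Finset.sum_const, Finset.card_univ, smul_eq_mul,
          Finset.sum_filter]
    _ < (n + 1) ^ m + ∑ y ∈ Finset.univ.filter (fun y => y ∉ X ∧ y ∉ G.comp X x),
            (n + 1) ^ (G.comp X y).card := by
        gcongr
        calc n * (n + 1) ^ (m - 1) < (n + 1) * (n + 1) ^ (m - 1) := by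
              have : 0 < (n + 1) ^ (m - 1) := by positivity
              nlinarith
          _ = (n + 1) ^ m := by rw [← pow_succ', Nat.sub_add_cancel hmpos]
    _ = ∑ y ∈ insert x (Finset.univ.filter (fun y => y ∉ X ∧ y ∉ G.comp X x)),
            (n + 1) ^ (G.comp X y).card := by
        rw [Finset.sum_insert (by simp [self_mem_comp])]
    _ ≤ G.potential X := by
        refine Finset.sum_le_sum_of_subset fun y hy => ?_
        rw [Finset.mem_insert, Finset.mem_filter] at hy
        rcases hy with rfl | hy
        · simpa using hx
        · simpa using hy.2.1

end comp

variable [Fintype V] [DecidableEq V]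

/-- The vertex set of the cycle enumerated by `c`. -/
def cycleSet (c : ℕ → V) (N : ℕ) : Finset V := (Finset.range N).image c

/-- `c` enumerates a cycle that cannot be improved with respect to the component `H` of the graph
off the cycle: no cycle meets `H` while leaving the omitted vertices of the old cycle in components
smaller than `H`. -/
structure IsExtremalCycle (G : SimpleGraph V) (c : ℕ → V) (N : ℕ) (H : Finset V) : Prop
    extends G.IsCyclicEnum c N where
  nonempty : H.Nonempty
  notMem : ∀ x ∈ H, x ∉ cycleSet c N
  closed : ∀ a ∈ H, ∀ b, G.Adj a b → b ∉ cycleSet c N → b ∈ H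
  connected : ∀ a ∈ H, ∀ b ∈ H, ∃ l, G.IsPathList a b l ∧ ∀ x ∈ l, x ∈ H
  no_improve : ∀ l, G.IsCycleList l → (∃ y ∈ H, y ∈ l) →
    (∀ y ∈ cycleSet c N, y ∉ l → (G.comp l.toFinset y).card < H.card) → False

omit [DecidableEq V] in
/-- Two vertices of one component of `G - X` are joined by a path inside that component. -/
lemma exists_isPathList_of_mem_comp {X : Finset V} {a b : V} (h : b ∈ G.comp X a) :
    ∃ l, G.IsPathList a b l ∧ ∀ x ∈ l, x ∈ G.comp X a := by
  classical
  obtain ⟨p⟩ := mem_comp.1 h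
  refine ⟨(p.toPath : (G.avoid X).Walk a b).support, ?_, fun x hx => ?_⟩
  · have := (p.toPath.2.mapLe (G.avoid_le X)).isPathList_support
    simpa using this
  · exact mem_comp.2 ((p.toPath : (G.avoid X).Walk a b).takeUntil x hx).reachable

/-- If `G` has an edge but is not hamiltonian, a cycle minimizing the potential is extremal. -/
lemma exists_isExtremalCycle (hn : 3 ≤ Fintype.card V) (hG : ¬ G.IsHamiltonian)
    (hedge : ∃ a b, G.Adj a b) : ∃ c N H, G.IsExtremalCycle c N H := by
  classical
  have hex : ∃ k, ∃ l, G.IsCycleList l ∧ G.potential l.toFinset = k := by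
    obtain ⟨a, b, hab⟩ := hedge
    refine ⟨_, [a] ++ [b], ?_, rfl⟩
    refine ((IsPathList.singleton G a).append (.singleton G b) hab ?_).isCycleList hab.symm
    simpa using hab.ne
  obtain ⟨l, hl, hmin⟩ := Nat.find_spec hex
  have hmin' : ∀ l', G.IsCycleList l' → G.potential l.toFinset ≤ G.potential l'.toFinset :=
    fun l' hl' => hmin ▸ Nat.find_min' hex ⟨l', hl', rfl⟩
  obtain ⟨x, hx⟩ : ∃ x, x ∉ l := by
    by_contra! hall
    exact hG (hl.isHamiltonian hn hall)
  obtain ⟨c, hc, hmem⟩ := hl.exists_enum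
  have hX : cycleSet c l.length = l.toFinset := by
    ext v
    simp [cycleSet, hmem]
  have hx' : x ∉ l.toFinset := by simpa using hx
  refine ⟨c, l.length, G.comp l.toFinset x, ⟨hc, ⟨x, self_mem_comp⟩, ?_, ?_, ?_, ?_⟩⟩
  · intro y hy
    rw [hX]
    exact notMem_of_mem_comp hx' hy
  · intro a ha b hab hb
    rw [hX] at hb
    exact mem_comp_of_adj ha hab (notMem_of_mem_comp hx' ha) hb
  · intro a ha b hb
    rw [← comp_eq_of_mem ha] at hb ⊢
    exact exists_isPathList_of_mem_comp hb
  · intro l' hl' hmeet hsmall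
    rw [hX] at hsmall
    refine absurd (hmin' l' hl') (not_le.2 (potential_lt hx' ?_ ?_))
    · obtain ⟨y, hy, hyl⟩ := hmeet
      exact ⟨y, hy, by simpa using hyl⟩
    · exact fun y hy hyl => hsmall y hy (by simpa using hyl)

end

section

variable {V : Type*} {G : SimpleGraph V} {c : ℕ → V} {N : ℕ} {H : Finset V}

/-! ### Rerouting an extremal cycle through a component -/

lemma IsCyclicEnum.mem_cycleSet [DecidableEq V] (h : G.IsCyclicEnum c N) (i : ℕ) :
    c i ∈ cycleSet c N := by
  have := h.two_le
  rw [cycleSet, Finset.mem_image]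
  exact ⟨i % N, Finset.mem_range.2 (Nat.mod_lt _ (by omega)), h.apply_mod i⟩

/-- The vertices of the cycle are met within one turn, wherever it begins. -/
lemma IsCyclicEnum.exists_index [DecidableEq V] (h : G.IsCyclicEnum c N) (s : ℕ) {v : V}
    (hv : v ∈ cycleSet c N) : ∃ r, s ≤ r ∧ r < s + N ∧ c r = v := by
  have hN := h.two_le
  obtain ⟨i, hi, rfl⟩ := Finset.mem_image.1 hv
  rw [Finset.mem_range] at hi
  refine ⟨s + (i + N - s % N) % N, by omega, ?_, ?_⟩
  · have := Nat.mod_lt (i + N - s % N) (show 0 < N by omega)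
    omega
  · rw [← h.apply_mod, ← h.apply_mod i]
    congr 1
    have hs := Nat.mod_lt s (show 0 < N by omega)
    rw [Nat.add_mod, Nat.mod_mod]
    rw [← Nat.mod_mod s N, ← Nat.add_mod, Nat.mod_mod]
    rw [show s % N + (i + N - s % N) = i + N by omega, Nat.add_mod_right]

/-- The `i`-th vertex of the cycle has a neighbour in `H`. -/
def Attached (G : SimpleGraph V) (c : ℕ → V) (H : Finset V) (i : ℕ) : Prop :=
  ∃ y ∈ H, G.Adj (c i) y

variable [Fintype V] [DecidableEq V]

/-- `p` and `q` are adjacent or joined by a path whose interior avoids the cycle. -/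
def Linked (G : SimpleGraph V) (c : ℕ → V) (N : ℕ) (p q : V) : Prop :=
  G.Adj p q ∨ ∃ y z, y ∉ cycleSet c N ∧ z ∈ G.comp (cycleSet c N) y ∧ G.Adj p y ∧ G.Adj z q

/-- The vertices `c (i + 1), …, c (i + a)` together with all components off the cycle that have a
neighbour among them. -/
noncomputable def tentacle (G : SimpleGraph V) (c : ℕ → V) (N i a : ℕ) : Finset V :=
  open Classical in Finset.univ.filter fun y => ∃ b, 1 ≤ b ∧ b ≤ a ∧ (y = c (i + b) ∨
    (y ∉ cycleSet c N ∧ ∃ w ∈ G.comp (cycleSet c N) y, G.Adj w (c (i + b))))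

lemma mem_tentacle {i a : ℕ} {y : V} : y ∈ G.tentacle c N i a ↔
    ∃ b, 1 ≤ b ∧ b ≤ a ∧ (y = c (i + b) ∨
      (y ∉ cycleSet c N ∧ ∃ w ∈ G.comp (cycleSet c N) y, G.Adj w (c (i + b)))) := by
  simp [tentacle]

/-- The least length from which on the tentacle that starts behind `c i` is at least as large
as `H`. -/
noncomputable def reach (G : SimpleGraph V) (c : ℕ → V) (N : ℕ) (H : Finset V) (i : ℕ) : ℕ :=
  sInf {a | H.card ≤ (G.tentacle c N i a).card}

lemma card_tentacle_lt {i a : ℕ} (ha : a < G.reach c N H i) :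
    (G.tentacle c N i a).card < H.card := by
  by_contra hlt
  exact absurd (Nat.sInf_le (not_lt.1 hlt) : G.reach c N H i ≤ a) (not_le.2 ha)

lemma Linked.symm {p q : V} (h : G.Linked c N p q) : G.Linked c N q p := by
  rcases h with h | ⟨y, z, hy, hz, hpy, hzq⟩
  · exact Or.inl h.symm
  · refine Or.inr ⟨z, y, notMem_of_mem_comp hy hz, ?_, hzq.symm, hpy.symm⟩
    rw [comp_eq_of_mem hz]
    exact self_mem_comp

/-- A tentacle is a union of components of the graph off `L` if none of its cycle vertices is
linked to the other cycle vertices missed by `L`. -/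
lemma tentacle_closed {i a : ℕ} {L : List V} (Y : V → Prop)
    (hX : ∀ y ∈ cycleSet c N, y ∉ L → (∃ b, 1 ≤ b ∧ b ≤ a ∧ y = c (i + b)) ∨ Y y)
    (hno : ∀ b, 1 ≤ b → b ≤ a → ∀ y, Y y → ¬ G.Linked c N (c (i + b)) y) :
    ∀ x ∈ G.tentacle c N i a, ∀ x', G.Adj x x' → x ∉ L → x' ∉ L →
      x' ∈ G.tentacle c N i a := by
  intro x hx x' hadj _ hx'L
  obtain ⟨b, hb1, hba, hxb⟩ := mem_tentacle.1 hx
  by_cases hx'X : x' ∈ cycleSet c N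
  · rcases hX x' hx'X hx'L with ⟨b', hb'1, hb'a, rfl⟩ | hY
    · exact mem_tentacle.2 ⟨b', hb'1, hb'a, Or.inl rfl⟩
    · refine absurd ?_ (hno b hb1 hba x' hY)
      rcases hxb with rfl | ⟨hxX, w, hw, hwb⟩
      · exact Or.inl hadj
      · refine Or.inr ⟨w, x, notMem_of_mem_comp hxX hw, ?_, hwb.symm, hadj⟩
        rw [comp_eq_of_mem hw]
        exact self_mem_comp
  · refine mem_tentacle.2 ⟨b, hb1, hba, Or.inr ⟨hx'X, ?_⟩⟩
    rcases hxb with rfl | ⟨hxX, w, hw, hwb⟩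
    · exact ⟨x', self_mem_comp, hadj.symm⟩
    · refine ⟨w, ?_, hwb⟩
      rwa [comp_eq_of_mem (mem_comp_of_adj self_mem_comp hadj hxX hx'X)]

namespace IsExtremalCycle

variable (h : G.IsExtremalCycle c N H)
include h

lemma attached_add_period {i : ℕ} (hi : G.Attached c H i) : G.Attached c H (i + N) := by
  rwa [Attached, h.add_period]

lemma comp_subset {y : V} (hy : y ∈ H) : G.comp (cycleSet c N) y ⊆ H :=
  SimpleGraph.comp_subset hy fun a ha b hab _ hb => h.closed a ha b hab hb

/-- A path between two attached vertices that misses `H` cannot be closed through `H` without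
leaving a vertex of the cycle in a large component. -/
lemma no_closing {i j : ℕ} {L : List V} (hL : G.IsPathList (c i) (c j) L)
    (hLH : ∀ x ∈ L, x ∉ H) (hi : G.Attached c H i) (hj : G.Attached c H j)
    (hsmall : ∀ y ∈ cycleSet c N, y ∉ L → ∃ T : Finset V, y ∈ T ∧ T.card < H.card ∧
      ∀ a ∈ T, ∀ b, G.Adj a b → a ∉ L → b ∉ L → b ∈ T) : False := by
  obtain ⟨a, ha, hia⟩ := hi
  obtain ⟨b, hb, hjb⟩ := hj
  obtain ⟨P, hP, hPH⟩ := h.connected b hb a ha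
  refine h.no_improve (L ++ P) ((hL.append hP hjb ?_).isCycleList hia.symm)
    ⟨a, ha, by simp [hP.last_mem]⟩ ?_
  · exact fun x hx hx' => hLH x hx (hPH x hx')
  · intro y hy hyL
    simp only [List.mem_append, not_or] at hyL
    obtain ⟨T, hyT, hT, hclosed⟩ := hsmall y hy hyL.1
    refine lt_of_le_of_lt (Finset.card_le_card (SimpleGraph.comp_subset hyT ?_)) hT
    intro a ha b hab ha' hb'
    simp only [List.mem_toFinset, List.mem_append, not_or] at ha' hb'
    exact hclosed a ha b hab ha'.1 hb'.1

/-- The stretch of the cycle between two attached vertices cannot be bypassed through `H`. -/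
lemma card_le_tentacle {i s : ℕ} (hi : G.Attached c H i) (his : G.Attached c H (i + s))
    (hs : 1 ≤ s) (hsN : s < N) : H.card ≤ (G.tentacle c N i (s - 1)).card := by
  by_contra hlt
  have hL := h.isPathList_arc (s := i + s) (e := i + N + 1) (by omega) (by omega)
  refine h.no_closing hL ?_ his (h.attached_add_period hi) ?_
  · intro x hx hxH
    obtain ⟨r, -, -, rfl⟩ := mem_arc.1 hx
    exact h.notMem _ hxH (h.mem_cycleSet r)
  · have hmiss : ∀ y ∈ cycleSet c N, y ∉ arc c (i + s) (i + N + 1) →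
        ∃ b, 1 ≤ b ∧ b ≤ s - 1 ∧ y = c (i + b) := by
      intro y hy hyL
      obtain ⟨r, hr1, hr2, rfl⟩ := h.exists_index (i + 1) hy
      rw [mem_arc] at hyL
      by_cases hr : i + s ≤ r
      · exact absurd ⟨r, hr, by omega, rfl⟩ hyL
      · exact ⟨r - i, by omega, by omega, by rw [show i + (r - i) = r by omega]⟩
    intro y hy hyL
    obtain ⟨b, hb1, hb2, rfl⟩ := hmiss y hy hyL
    exact ⟨G.tentacle c N i (s - 1), mem_tentacle.2 ⟨b, hb1, hb2, Or.inl rfl⟩, not_le.1 hlt,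
      tentacle_closed (fun _ => False) (fun y hy hyL => Or.inl (hmiss y hy hyL))
        (fun _ _ _ _ hf => hf.elim)⟩

lemma reach_lt {i s : ℕ} (hi : G.Attached c H i) (his : G.Attached c H (i + s))
    (hs : 1 ≤ s) (hsN : s < N) : G.reach c N H i < s := by
  have : G.reach c N H i ≤ s - 1 := Nat.sInf_le (h.card_le_tentacle hi his hs hsN)
  omega

lemma card_le_tentacle_reach {i s : ℕ} (hi : G.Attached c H i) (his : G.Attached c H (i + s))
    (hs : 1 ≤ s) (hsN : s < N) : H.card ≤ (G.tentacle c N i (G.reach c N H i)).card :=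
  Nat.sInf_mem (s := {a | H.card ≤ (G.tentacle c N i a).card})
    ⟨_, h.card_le_tentacle hi his hs hsN⟩

lemma one_le_reach {i s : ℕ} (hi : G.Attached c H i) (his : G.Attached c H (i + s))
    (hs : 1 ≤ s) (hsN : s < N) : 1 ≤ G.reach c N H i := by
  have h1 := h.card_le_tentacle_reach hi his hs hsN
  have h2 := Finset.card_pos.2 h.nonempty
  by_contra hlt
  have h3 : G.tentacle c N i (G.reach c N H i) = ∅ := by
    ext y
    simp only [mem_tentacle, Finset.notMem_empty, iff_false]
    rintro ⟨b, hb, hb', -⟩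
    omega
  rw [h3, Finset.card_empty] at h1
  omega

/-- Two disjoint paths along the cycle whose ends are linked join up to one path missing `H`. -/
lemma exists_join {a b p q : V} {L₁ L₂ : List V} (h₁ : G.IsPathList a p L₁)
    (h₂ : G.IsPathList q b L₂) (hX₁ : ∀ x ∈ L₁, x ∈ cycleSet c N)
    (hX₂ : ∀ x ∈ L₂, x ∈ cycleSet c N) (hd : ∀ x ∈ L₁, x ∉ L₂) (hpq : G.Linked c N p q)
    (hp : ∀ y ∈ H, ¬ G.Adj p y) :
    ∃ L, G.IsPathList a b L ∧ (∀ x ∈ L₁, x ∈ L) ∧ (∀ x ∈ L₂, x ∈ L) ∧ ∀ x ∈ L, x ∉ H := by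
  have hH : ∀ x ∈ cycleSet c N, x ∉ H := fun x hx hxH => h.notMem x hxH hx
  rcases hpq with hpq | ⟨y, z, hy, hz, hpy, hzq⟩
  · refine ⟨L₁ ++ L₂, h₁.append h₂ hpq hd, by simp +contextual, by simp +contextual, ?_⟩
    intro x hx
    rcases List.mem_append.1 hx with hx | hx
    · exact hH x (hX₁ x hx)
    · exact hH x (hX₂ x hx)
  · obtain ⟨Q, hQ, hQc⟩ := exists_isPathList_of_mem_comp hz
    have hQX : ∀ x ∈ Q, x ∉ cycleSet c N := fun x hx => notMem_of_mem_comp hy (hQc x hx)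
    have hQH : ∀ x ∈ Q, x ∉ H := by
      intro x hx hxH
      refine hp y (h.comp_subset hxH ?_) hpy
      rw [comp_eq_of_mem (hQc x hx)]
      exact self_mem_comp
    refine ⟨L₁ ++ Q ++ L₂, (h₁.append hQ hpy ?_).append h₂ hzq ?_, by simp +contextual,
      by simp +contextual, ?_⟩
    · exact fun x hx hxQ => hQX x hxQ (hX₁ x hx)
    · intro x hx hx2
      rcases List.mem_append.1 hx with hx | hx
      · exact hd x hx hx2
      · exact hQX x hx (hX₂ x hx2)
    · intro x hx
      simp only [List.mem_append] at hx
      rcases hx with (hx | hx) | hx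
      · exact hH x (hX₁ x hx)
      · exact hQH x hx
      · exact hH x (hX₂ x hx)

/-- Up to their reaches, the cycle vertices behind two different attached vertices are not linked:
a link that is closest to the two attached vertices would allow a detour through `H` that omits
only vertices in two tentacles smaller than `H`. -/
lemma not_linked {i j : ℕ} (hi : G.Attached c H i) (hj : G.Attached c H j) (hij : i < j)
    (hjN : j < i + N) : ∀ n a b : ℕ, a + b = n → 1 ≤ a → a ≤ G.reach c N H i → 1 ≤ b →
      b ≤ G.reach c N H j → ¬ G.Linked c N (c (i + a)) (c (j + b)) := by
  intro n
  induction n using Nat.strong_induction_on with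
  | _ n ih =>
  intro a b hn ha ha' hb hb' hlink
  have hjj : G.Attached c H (i + (j - i)) := by rwa [Nat.add_sub_cancel' hij.le]
  have hii : G.Attached c H (j + (i + N - j)) := by
    rw [Nat.add_sub_cancel' hjN.le]; exact h.attached_add_period hi
  have hri := h.reach_lt hi hjj (by omega) (by omega)
  have hrj := h.reach_lt hj hii (by omega) (by omega)
  have hL₁ := (h.isPathList_arc (s := j + b) (e := i + N + 1) (by omega) (by omega)).reverse
  have hL₂ := h.isPathList_arc (s := i + a) (e := j + 1) (by omega) (by omega)
  have hsub : ∀ s e, ∀ x ∈ arc c s e, x ∈ cycleSet c N := by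
    intro s e x hx
    obtain ⟨r, -, -, rfl⟩ := mem_arc.1 hx
    exact h.mem_cycleSet r
  obtain ⟨L, hL, hLL₁, hLL₂, hLH⟩ := h.exists_join hL₁ hL₂
    (fun x hx => hsub _ _ x (List.mem_reverse.1 hx)) (hsub _ _)
    (fun x hx => h.arc_disjoint (s := i + 1) (by omega) (by omega) (by omega) (by omega)
      (by omega) x (List.mem_reverse.1 hx)) hlink.symm (by
      intro y hy hyj
      have := h.reach_lt (s := b) hj ⟨y, hy, hyj⟩ (by omega) (by omega)
      omega)
  -- the cycle vertices missed by `L` lie strictly before `c (i + a)` or before `c (j + b)`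
  have hmiss : ∀ y ∈ cycleSet c N, y ∉ L → (∃ a', 1 ≤ a' ∧ a' ≤ a - 1 ∧ y = c (i + a')) ∨
      (∃ b', 1 ≤ b' ∧ b' ≤ b - 1 ∧ y = c (j + b')) := by
    intro y hy hyL
    obtain ⟨r, hr1, hr2, rfl⟩ := h.exists_index (i + 1) hy
    have h1 : ¬ (i + a ≤ r ∧ r < j + 1) := fun hr =>
      hyL (hLL₂ _ (mem_arc.2 ⟨r, hr.1, hr.2, rfl⟩))
    have h2 : ¬ (j + b ≤ r ∧ r < i + N + 1) := fun hr =>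
      hyL (hLL₁ _ (List.mem_reverse.2 (mem_arc.2 ⟨r, hr.1, hr.2, rfl⟩)))
    by_cases hr : r ≤ j
    · exact Or.inl ⟨r - i, by omega, by omega, by rw [show i + (r - i) = r by omega]⟩
    · exact Or.inr ⟨r - j, by omega, by omega, by rw [show j + (r - j) = r by omega]⟩
  refine h.no_closing hL hLH (h.attached_add_period hi) hj fun y hy hyL => ?_
  rcases hmiss y hy hyL with ⟨a', ha'1, ha'2, rfl⟩ | ⟨b', hb'1, hb'2, rfl⟩
  · refine ⟨G.tentacle c N i (a - 1), mem_tentacle.2 ⟨a', ha'1, ha'2, Or.inl rfl⟩,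
      card_tentacle_lt (by omega), tentacle_closed _ hmiss ?_⟩
    rintro a'' h1 h2 y ⟨b'', h3, h4, rfl⟩
    exact ih (a'' + b'') (by omega) a'' b'' rfl h1 (by omega) h3 (by omega)
  · refine ⟨G.tentacle c N j (b - 1), mem_tentacle.2 ⟨b', hb'1, hb'2, Or.inl rfl⟩,
      card_tentacle_lt (by omega),
      tentacle_closed _ (fun y hy hyL => (hmiss y hy hyL).symm) ?_⟩
    rintro b'' h1 h2 y ⟨a'', h3, h4, rfl⟩ hl
    exact ih (a'' + b'') (by omega) a'' b'' rfl h3 (by omega) h1 (by omega) hl.symm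

/-- A Hamiltonian path of the cycle cannot join two attached vertices. -/
lemma no_spanning_path {i j : ℕ} {L : List V} (hL : G.IsPathList (c i) (c j) L)
    (hi : G.Attached c H i) (hj : G.Attached c H j) (hLX : ∀ x, x ∈ L ↔ x ∈ cycleSet c N) :
    False :=
  h.no_closing hL (fun x hx hxH => h.notMem x hxH ((hLX x).1 hx)) hi hj
    fun y hy hyL => absurd ((hLX y).2 hy) hyL

lemma mem_cycleSet_iff_arc (s : ℕ) (x : V) : x ∈ cycleSet c N ↔ x ∈ arc c s (s + N) := by
  rw [mem_arc]
  constructor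
  · intro hx
    exact h.exists_index s hx
  · rintro ⟨r, -, -, rfl⟩
    exact h.mem_cycleSet r

/-- Reordering the cycle as `v_p … z⁺ u_q … z u_p … v_q`, where `v_p`, `v_q` are attached, `u_p`,
`u_q` are their successors and `z = c j`. -/
lemma not_crossing {j p q : ℕ} (hp : G.Attached c H p) (hq : G.Attached c H q) (hjp : j < p)
    (hpq : p < q) (hqN : q < j + N) (h1 : G.Adj (c j) (c (p + 1)))
    (h2 : G.Adj (c (j + 1)) (c (q + 1))) : False := by
  have A₁ := (h.isPathList_arc (s := j + 1) (e := p + 1) (by omega) (by omega)).reverse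
  have A₂ := h.isPathList_arc (s := p + 1) (e := q + 1) (by omega) (by omega)
  have A₃ := h.isPathList_arc (s := q + 1) (e := j + 1 + N) (by omega) (by omega)
  have hz : c (j + 1 + N - 1) = c j := by
    rw [show j + 1 + N - 1 = j + N by omega, h.add_period]
  rw [hz] at A₃
  have hdisj {s₁ e₁ s₂ e₂ : ℕ} (h1 : j + 1 ≤ s₁) (h2 : j + 1 ≤ s₂) (h3 : e₁ ≤ j + 1 + N)
      (h4 : e₂ ≤ j + 1 + N) (h5 : e₁ ≤ s₂ ∨ e₂ ≤ s₁) {x : V} (hx : x ∈ arc c s₁ e₁) :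
      x ∉ arc c s₂ e₂ := h.arc_disjoint h1 h2 h3 h4 h5 x hx
  refine h.no_spanning_path ((A₁.append A₃ h2 ?_).append A₂ h1 ?_) hp hq ?_
  · intro x hx
    exact hdisj (by omega) (by omega) (by omega) (by omega) (by omega) (List.mem_reverse.1 hx)
  · intro x hx
    simp only [List.mem_append, List.mem_reverse] at hx
    rcases hx with hx | hx <;>
      exact hdisj (by omega) (by omega) (by omega) (by omega) (by omega) hx
  · intro x
    rw [h.mem_cycleSet_iff_arc (j + 1)]
    simp only [List.mem_append, List.mem_reverse, mem_arc]
    grind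

/-- Reordering the cycle as `v_p … z⁺ u_q … z' z … z'⁺ u_p … v_q`, where `z = c j` and
`z' = c r`. -/
lemma not_crossing_of_lt {j p q r : ℕ} (hp : G.Attached c H p) (hq : G.Attached c H q)
    (hjp : j < p) (hpq : p < q) (hqr : q < r) (hrN : r < j + N) (h1 : G.Adj (c j) (c r))
    (h2 : G.Adj (c (r + 1)) (c (p + 1))) (h3 : G.Adj (c (j + 1)) (c (q + 1))) : False := by
  have A₁ := (h.isPathList_arc (s := j + 1) (e := p + 1) (by omega) (by omega)).reverse
  have A₂ := h.isPathList_arc (s := p + 1) (e := q + 1) (by omega) (by omega)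
  have A₃ := h.isPathList_arc (s := q + 1) (e := r + 1) (by omega) (by omega)
  have A₄ := (h.isPathList_arc (s := r + 1) (e := j + 1 + N) (by omega) (by omega)).reverse
  have hz : c (j + 1 + N - 1) = c j := by
    rw [show j + 1 + N - 1 = j + N by omega, h.add_period]
  rw [hz] at A₄
  have hdisj {s₁ e₁ s₂ e₂ : ℕ} (h1 : j + 1 ≤ s₁) (h2 : j + 1 ≤ s₂) (h3 : e₁ ≤ j + 1 + N)
      (h4 : e₂ ≤ j + 1 + N) (h5 : e₁ ≤ s₂ ∨ e₂ ≤ s₁) {x : V} (hx : x ∈ arc c s₁ e₁) :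
      x ∉ arc c s₂ e₂ := h.arc_disjoint h1 h2 h3 h4 h5 x hx
  refine h.no_spanning_path (((A₁.append A₃ h3 ?_).append A₄ h1.symm ?_).append A₂ h2 ?_)
    hp hq ?_
  · intro x hx
    exact hdisj (by omega) (by omega) (by omega) (by omega) (by omega) (List.mem_reverse.1 hx)
  · intro x hx
    simp only [List.mem_append, List.mem_reverse] at hx ⊢
    rcases hx with hx | hx <;>
      exact hdisj (by omega) (by omega) (by omega) (by omega) (by omega) hx
  · intro x hx
    simp only [List.mem_append, List.mem_reverse] at hx
    rcases hx with (hx | hx) | hx <;>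
      exact hdisj (by omega) (by omega) (by omega) (by omega) (by omega) hx
  · intro x
    rw [h.mem_cycleSet_iff_arc (j + 1)]
    simp only [List.mem_append, List.mem_reverse, mem_arc]
    grind

/-- Reordering the cycle as `v_p … z⁺ u_q … z z' … u_p z'⁺ … v_q`, where `z = c j` and
`z' = c r`. -/
lemma not_crossing_of_gt {j p q r : ℕ} (hp : G.Attached c H p) (hq : G.Attached c H q)
    (hjp : j < p) (hpr : p < r) (hrq : r < q) (hqN : q < j + N) (h1 : G.Adj (c j) (c r))
    (h2 : G.Adj (c (r + 1)) (c (p + 1))) (h3 : G.Adj (c (j + 1)) (c (q + 1))) : False := by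
  have A₁ := (h.isPathList_arc (s := j + 1) (e := p + 1) (by omega) (by omega)).reverse
  have A₂ := (h.isPathList_arc (s := p + 1) (e := r + 1) (by omega) (by omega)).reverse
  have A₃ := h.isPathList_arc (s := r + 1) (e := q + 1) (by omega) (by omega)
  have A₄ := h.isPathList_arc (s := q + 1) (e := j + 1 + N) (by omega) (by omega)
  have hz : c (j + 1 + N - 1) = c j := by
    rw [show j + 1 + N - 1 = j + N by omega, h.add_period]
  rw [hz] at A₄
  have hdisj {s₁ e₁ s₂ e₂ : ℕ} (h1 : j + 1 ≤ s₁) (h2 : j + 1 ≤ s₂) (h3 : e₁ ≤ j + 1 + N)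
      (h4 : e₂ ≤ j + 1 + N) (h5 : e₁ ≤ s₂ ∨ e₂ ≤ s₁) {x : V} (hx : x ∈ arc c s₁ e₁) :
      x ∉ arc c s₂ e₂ := h.arc_disjoint h1 h2 h3 h4 h5 x hx
  refine h.no_spanning_path (((A₁.append A₄ h3 ?_).append A₂ h1 ?_).append A₃ h2.symm ?_)
    hp hq ?_
  · intro x hx
    exact hdisj (by omega) (by omega) (by omega) (by omega) (by omega) (List.mem_reverse.1 hx)
  · intro x hx
    simp only [List.mem_append, List.mem_reverse] at hx ⊢
    rcases hx with hx | hx <;>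
      exact hdisj (by omega) (by omega) (by omega) (by omega) (by omega) hx
  · intro x hx
    simp only [List.mem_append, List.mem_reverse] at hx
    rcases hx with (hx | hx) | hx <;>
      exact hdisj (by omega) (by omega) (by omega) (by omega) (by omega) hx
  · intro x
    rw [h.mem_cycleSet_iff_arc (j + 1)]
    simp only [List.mem_append, List.mem_reverse, mem_arc]
    grind

end IsExtremalCycle

end

section

variable {V : Type*} {G : SimpleGraph V} [Fintype V] {t : ℝ}

/-! ### Consequences of toughness -/

/-- At least two nonempty, pairwise disjoint and pairwise nonadjacent vertex sets are separated by
the set of all other vertices. -/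
lemma IsTough.mul_card_add_sum_le (hG : G.IsTough t) (ht : 0 ≤ t) {ι : Type*} (T : Finset ι)
    (hT : 2 ≤ T.card) (B : ι → Finset V) (hB : ∀ i ∈ T, (B i).Nonempty)
    (hBB : ∀ i ∈ T, ∀ j ∈ T, i ≠ j → ∀ x ∈ B i, x ∉ B j ∧ ∀ y ∈ B j, ¬ G.Adj x y) :
    t * T.card + ∑ i ∈ T, ((B i).card : ℝ) ≤ Fintype.card V := by
  classical
  set U : Finset V := T.biUnion B with hU
  set S : Set V := {v | v ∉ U} with hS
  have hUcard : U.card = ∑ i ∈ T, (B i).card := by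
    refine Finset.card_biUnion fun i hi j hj hij => ?_
    exact Finset.disjoint_left.2 fun x hx => (hBB i hi j hj hij x hx).1
  have hSU : ∀ x ∈ U, x ∈ Sᶜ := fun x hx hx' => hx' hx
  have hScard : S.ncard = Fintype.card V - U.card := by
    rw [← Finset.card_compl, ← Set.ncard_coe_finset]
    congr 1
    ext x
    simp [hS]
  have hclosed : ∀ i ∈ T, ∀ x y : (Sᶜ : Set V), (G.induce Sᶜ).Reachable x y → x.1 ∈ B i →
      y.1 ∈ B i := by
    rintro i hi x y ⟨p⟩ hx
    induction p with
    | nil => exact hx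
    | @cons a b _ hadj p ih =>
      refine ih ?_
      obtain ⟨j, hj, hbj⟩ : ∃ j ∈ T, b.1 ∈ B j := by
        have : b.1 ∈ U := not_not.1 b.2
        simpa [hU] using this
      by_cases hij : i = j
      · rwa [hij]
      · exact absurd hadj ((hBB i hi j hj hij a.1 hx).2 b.1 hbj)
  choose r hr using fun i : T => hB i i.2
  have hrS : ∀ i : T, r i ∈ Sᶜ := fun i =>
    hSU _ (Finset.mem_biUnion.2 ⟨i, i.2, hr i⟩)
  have hcard : T.card ≤ Nat.card (G.induce Sᶜ).ConnectedComponent := by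
    have hinj : Function.Injective
        fun i : T => (G.induce Sᶜ).connectedComponentMk ⟨r i, hrS i⟩ := by
      intro i j hij
      have hreach := ConnectedComponent.exact hij
      by_contra hne
      have hmem := hclosed i i.2 _ _ hreach (hr i)
      exact (hBB i i.2 j j.2 (fun h => hne (Subtype.ext h)) _ hmem).1 (hr j)
    simpa using Nat.card_le_card_of_injective _ hinj
  have h1 := hG S (hT.trans hcard)
  have h2 : U.card ≤ Fintype.card V := Finset.card_le_univ U
  rw [hScard, Nat.cast_sub h2] at h1
  have h3 : t * T.card ≤ t * (Nat.card (G.induce Sᶜ).ConnectedComponent : ℝ) := by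
    gcongr
  have h4 : (U.card : ℝ) = ∑ i ∈ T, ((B i).card : ℝ) := by rw [hUcard]; push_cast; rfl
  linarith

/-- The form of `IsTough.mul_card_add_sum_le` with one set singled out. -/
lemma IsTough.mul_card_succ_add_sum_le (hG : G.IsTough t) (ht : 0 ≤ t) {ι : Type*}
    {T : Finset ι} (hT : T.Nonempty) {H : Finset V} (hH : H.Nonempty) {B : ι → Finset V}
    (hB : ∀ i ∈ T, (B i).Nonempty)
    (hBH : ∀ i ∈ T, ∀ x ∈ B i, x ∉ H ∧ ∀ y ∈ H, ¬ G.Adj x y)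
    (hBB : ∀ i ∈ T, ∀ j ∈ T, i ≠ j → ∀ x ∈ B i, x ∉ B j ∧ ∀ y ∈ B j, ¬ G.Adj x y) :
    t * (T.card + 1) + H.card + ∑ i ∈ T, ((B i).card : ℝ) ≤ Fintype.card V := by
  have hTc : 0 < T.card := Finset.card_pos.2 hT
  have := hG.mul_card_add_sum_le ht (Finset.insertNone T) (by simp; omega)
    (fun o => o.elim H B) ?_ ?_
  · rw [Finset.sum_insertNone, Finset.card_insertNone] at this
    push_cast at this
    simp only [Option.elim_none, Option.elim_some] at this
    linarith
  · rintro (_ | i) hi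
    · exact hH
    · exact hB i (Finset.some_mem_insertNone.1 hi)
  · rintro (_ | i) hi (_ | j) hj hij x hx
    · exact absurd rfl hij
    · have hj' := Finset.some_mem_insertNone.1 hj
      exact ⟨fun hxj => (hBH j hj' x hxj).1 hx, fun y hy hxy => (hBH j hj' y hy).2 x hx hxy.symm⟩
    · exact hBH i (Finset.some_mem_insertNone.1 hi) x hx
    · exact hBB i (Finset.some_mem_insertNone.1 hi) j (Finset.some_mem_insertNone.1 hj)
        (fun h => hij (congrArg some h)) x hx

lemma IsTough.exists_adj (hG : G.IsTough t) (ht : 0 < t) (hn : 2 ≤ Fintype.card V) :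
    ∃ a b, G.Adj a b := by
  classical
  by_contra! hno
  obtain ⟨x⟩ : Nonempty V := Fintype.card_pos_iff.1 (by omega)
  have hcard : (Finset.univ.erase x).card = Fintype.card V - 1 := by
    rw [Finset.card_erase_of_mem (Finset.mem_univ x), Finset.card_univ]
  have := hG.mul_card_succ_add_sum_le ht.le (T := {()}) (Finset.singleton_nonempty _)
    (H := {x}) (Finset.singleton_nonempty _) (B := fun _ => Finset.univ.erase x)
    (fun _ _ => Finset.card_pos.1 (by omega))
    (fun _ _ y hy => ⟨by simpa using hy, fun _ _ => hno _ _⟩)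
    (fun _ _ _ _ hij => absurd rfl hij)
  simp only [Finset.card_singleton, Finset.sum_const, hcard, Nat.cast_one, one_smul,
    Nat.cast_sub (show 1 ≤ Fintype.card V by omega)] at this
  linarith

/-- Ore's condition implies `1`-toughness: representatives of the components of `G - S` are not
adjacent to each other, and two of them have only vertices of `S` as common neighbours. -/
lemma isTough_one_of_card_le_degree_add [DecidableRel G.Adj]
    (h : ∀ u v, u ≠ v → ¬ G.Adj u v → Fintype.card V ≤ G.degree u + G.degree v) :
    G.IsTough 1 := by
  classical
  intro S hS
  rw [one_mul, Nat.cast_le]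
  set K := (G.induce Sᶜ).ConnectedComponent with hK
  have hout : ∀ x : K, (G.induce Sᶜ).connectedComponentMk x.out = x := fun x => Quot.out_eq x
  set r : K → V := fun x => (x.out : (Sᶜ : Set V)).1 with hr
  have hrinj : Function.Injective r := by
    intro x y hxy
    rw [← hout x, ← hout y, Subtype.ext hxy]
  have hrS : ∀ x, r x ∉ S := fun x => x.out.2
  have hsame : ∀ (x : K) (y : V) (hy : y ∉ S), G.Adj (r x) y →
      (G.induce Sᶜ).connectedComponentMk ⟨y, hy⟩ = x := by
    intro x y hy hadj
    rw [← hout x]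
    refine (ConnectedComponent.sound (Adj.reachable ?_)).symm
    exact hadj
  have hcardK : Nat.card K = Fintype.card K := Nat.card_eq_fintype_card
  obtain ⟨x, y, hxy⟩ := Fintype.one_lt_card_iff.1 (by rw [← hcardK]; omega : 1 < Fintype.card K)
  have hnadj : ∀ x y : K, ¬ G.Adj (r x) (r y) := by
    intro x y hadj
    have : y = x := by rw [← hsame x (r y) (hrS y) hadj]; exact (hout y).symm
    rw [this] at hadj
    exact G.irrefl hadj
  have hdeg := h (r x) (r y) (fun he => hxy (hrinj he)) (hnadj x y)
  have hinter : (G.neighborFinset (r x) ∩ G.neighborFinset (r y)).card ≤ S.ncard := by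
    rw [Set.ncard_eq_toFinset_card']
    refine Finset.card_le_card fun z hz => ?_
    rw [Finset.mem_inter, mem_neighborFinset, mem_neighborFinset] at hz
    rw [Set.mem_toFinset]
    by_contra hzS
    exact hxy ((hsame x z hzS hz.1).symm.trans (hsame y z hzS hz.2))
  have hunion : (G.neighborFinset (r x) ∪ G.neighborFinset (r y)).card + Nat.card K ≤
      Fintype.card V := by
    have hdisj : Disjoint (G.neighborFinset (r x) ∪ G.neighborFinset (r y))
        (Finset.univ.image r) := by
      rw [Finset.disjoint_left]
      intro z hz hz'
      obtain ⟨w, -, rfl⟩ := Finset.mem_image.1 hz'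
      rw [Finset.mem_union, mem_neighborFinset, mem_neighborFinset] at hz
      rcases hz with hz | hz <;> exact hnadj _ _ hz
    rw [hcardK, ← Finset.card_univ (α := K), ← Finset.card_image_of_injective _ hrinj,
      ← Finset.card_union_of_disjoint hdisj]
    exact Finset.card_le_univ _
  have := Finset.card_union_add_card_inter (G.neighborFinset (r x)) (G.neighborFinset (r y))
  rw [card_neighborFinset_eq_degree, card_neighborFinset_eq_degree] at this
  omega

lemma lt_degree_add_of_lt_sigmaTwo [DecidableRel G.Adj] {b : ℝ}
    (h : ((b : ℝ) : EReal) < G.sigmaTwo) {u v : V} (huv : u ≠ v) (hadj : ¬ G.Adj u v) :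
    b < G.degree u + G.degree v := by
  have h1 : G.sigmaTwo ≤ ((G.degree u + G.degree v : ℕ) : EReal) :=
    iInf_le_of_le u (iInf_le_of_le v (iInf_le_of_le huv (iInf_le _ hadj)))
  have h2 := h.trans_le h1
  rw [show (((G.degree u + G.degree v : ℕ)) : EReal) = (((G.degree u + G.degree v : ℕ) : ℝ) : EReal)
    from rfl, EReal.coe_lt_coe_iff] at h2
  exact_mod_cast h2

end

section

variable {V : Type*} {G : SimpleGraph V} {c : ℕ → V} {N : ℕ} {H : Finset V}

/-! ### Attached vertices and their successors -/

open Classical in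
/-- The indices, within one turn, of the cycle vertices that have a neighbour in `H`. -/
noncomputable def attachedIndices (G : SimpleGraph V) (c : ℕ → V) (N : ℕ) (H : Finset V) :
    Finset ℕ :=
  (Finset.range N).filter (G.Attached c H)

lemma mem_attachedIndices {i : ℕ} :
    i ∈ G.attachedIndices c N H ↔ i < N ∧ G.Attached c H i := by
  simp [attachedIndices]

lemma not_attached_of_notMem {j : ℕ} (hj : j < N) (hjI : j ∉ G.attachedIndices c N H) :
    ¬ G.Attached c H j := fun ha => hjI (mem_attachedIndices.2 ⟨hj, ha⟩)

open Classical in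
/-- The indices `j` such that the successor of `c j` is adjacent to `c (p + 1)` and to a further
successor `c (q + 1)` of an attached vertex that comes after `c (p + 1)` when the cycle is traversed
from `c j` on. -/
noncomputable def crossIndices (G : SimpleGraph V) (c : ℕ → V) (N : ℕ) (H : Finset V) (p : ℕ) :
    Finset ℕ :=
  (Finset.range N).filter fun j => G.Adj (c (p + 1)) (c (j + 1)) ∧
    ∃ q ∈ G.attachedIndices c N H, G.Adj (c (q + 1)) (c (j + 1)) ∧
      (p + N - j) % N < (q + N - j) % N

lemma mem_crossIndices {p j : ℕ} : j ∈ G.crossIndices c N H p ↔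
    j < N ∧ G.Adj (c (p + 1)) (c (j + 1)) ∧
      ∃ q ∈ G.attachedIndices c N H, G.Adj (c (q + 1)) (c (j + 1)) ∧
        (p + N - j) % N < (q + N - j) % N := by
  simp [crossIndices]

lemma offset_eq {N p j : ℕ} (hp : p < N) (hj : j < N) :
    j + (p + N - j) % N = if j ≤ p then p else p + N := by
  split_ifs with h
  · rw [show p + N - j = p - j + N by omega, Nat.add_mod_right, Nat.mod_eq_of_lt (by omega)]
    omega
  · rw [Nat.mod_eq_of_lt (by omega)]
    omega

variable [Fintype V] [DecidableEq V]

namespace IsExtremalCycle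

variable (h : G.IsExtremalCycle c N H) {t : ℝ}
include h

lemma notMem_H (j : ℕ) : c j ∉ H := fun hH => h.notMem _ hH (h.mem_cycleSet j)

/-- Separating `H` from the rest of the graph by its attached vertices. -/
lemma two_mul_le_of_not_attached (hG : G.IsTough t) (ht : 0 ≤ t) {j : ℕ} (hjN : j < N)
    (hj : ¬ G.Attached c H j) : 2 * t ≤ (G.attachedIndices c N H).card := by
  set W := (G.attachedIndices c N H).image c with hW
  have hdisj : Disjoint W H := by
    rw [Finset.disjoint_left]
    intro x hx
    obtain ⟨i, -, rfl⟩ := Finset.mem_image.1 hx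
    exact h.notMem_H i
  have hcard : W.card ≤ (G.attachedIndices c N H).card := Finset.card_image_le
  have hWH : (W ∪ H).card = W.card + H.card := Finset.card_union_of_disjoint hdisj
  have hcompl : (W ∪ H)ᶜ.card = Fintype.card V - (W ∪ H).card := Finset.card_compl _
  have hle : (W ∪ H).card ≤ Fintype.card V := Finset.card_le_univ _
  have := hG.mul_card_succ_add_sum_le ht (T := {()}) (Finset.singleton_nonempty _)
    h.nonempty (B := fun _ => (W ∪ H)ᶜ) (fun _ _ => ⟨c j, ?_⟩) ?_
    (fun _ _ _ _ hij => absurd rfl hij)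
  · simp only [Finset.card_singleton, Finset.sum_const, one_smul, hcompl, Nat.cast_sub hle,
      Nat.cast_one] at this
    rw [hWH, Nat.cast_add] at this
    have : (W.card : ℝ) ≤ (G.attachedIndices c N H).card := by exact_mod_cast hcard
    linarith
  · simp only [Finset.mem_compl, Finset.mem_union, not_or]
    refine ⟨fun hx => ?_, h.notMem_H j⟩
    obtain ⟨i, hi, hij⟩ := Finset.mem_image.1 hx
    rw [mem_attachedIndices] at hi
    exact hj (h.inj i j hi.1 hjN hij ▸ hi.2)
  · intro _ _ x hx
    simp only [Finset.mem_compl, Finset.mem_union, not_or] at hx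
    refine ⟨hx.2, fun y hy hxy => ?_⟩
    by_cases hxX : x ∈ cycleSet c N
    · obtain ⟨i, hi, rfl⟩ := Finset.mem_image.1 hxX
      exact hx.1 (Finset.mem_image.2
        ⟨i, mem_attachedIndices.2 ⟨Finset.mem_range.1 hi, y, hy, hxy⟩, rfl⟩)
    · exact hx.2 (h.closed y hy x hxy.symm hxX)

lemma two_le_card (hG : G.IsTough t) (ht : 1 ≤ t) : 2 ≤ (G.attachedIndices c N H).card := by
  by_contra hlt
  obtain ⟨j, hj, hjI⟩ : ∃ j ∈ Finset.range N, j ∉ G.attachedIndices c N H := by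
    refine Finset.exists_mem_notMem_of_card_lt_card ?_
    have := h.two_le
    rw [Finset.card_range]
    omega
  rw [Finset.mem_range] at hj
  have h1 := h.two_mul_le_of_not_attached hG (by linarith) hj (not_attached_of_notMem hj hjI)
  have h2 : (2 : ℝ) ≤ (G.attachedIndices c N H).card := by linarith
  exact hlt (by exact_mod_cast h2)

variable (hk : 2 ≤ (G.attachedIndices c N H).card)
include hk

lemma exists_attached_add {p : ℕ} (hp : p ∈ G.attachedIndices c N H) :
    ∃ s, 1 ≤ s ∧ s < N ∧ G.Attached c H (p + s) := by
  obtain ⟨q, hq, hqp⟩ :=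
    Finset.exists_mem_ne (show 1 < (G.attachedIndices c N H).card by omega) p
  rw [mem_attachedIndices] at hp hq
  rcases lt_or_gt_of_ne hqp with hlt | hlt
  · refine ⟨q + N - p, by omega, by omega, ?_⟩
    rw [show p + (q + N - p) = q + N by omega]
    exact h.attached_add_period hq.2
  · refine ⟨q - p, by omega, by omega, ?_⟩
    rw [show p + (q - p) = q by omega]
    exact hq.2

lemma not_attached_add {p b : ℕ} (hp : p ∈ G.attachedIndices c N H) (hb : 1 ≤ b)
    (hbr : b ≤ G.reach c N H p) : ¬ G.Attached c H (p + b) := by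
  intro ha
  obtain ⟨s, hs, hsN, hps⟩ := h.exists_attached_add hk hp
  rw [mem_attachedIndices] at hp
  have := h.reach_lt hp.2 hps hs hsN
  have := h.reach_lt hp.2 ha hb (by omega)
  omega

lemma one_le_reach_of_mem {p : ℕ} (hp : p ∈ G.attachedIndices c N H) : 1 ≤ G.reach c N H p := by
  obtain ⟨s, hs, hsN, hps⟩ := h.exists_attached_add hk hp
  exact h.one_le_reach (mem_attachedIndices.1 hp).2 hps hs hsN

lemma not_attached_succ {p : ℕ} (hp : p ∈ G.attachedIndices c N H) :
    ¬ G.Attached c H (p + 1) :=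
  h.not_attached_add hk hp le_rfl (h.one_le_reach_of_mem hk hp)

omit hk in
lemma not_linked_of_ne {p q a b : ℕ} (hp : p ∈ G.attachedIndices c N H)
    (hq : q ∈ G.attachedIndices c N H) (hpq : p ≠ q) (ha : 1 ≤ a) (ha' : a ≤ G.reach c N H p)
    (hb : 1 ≤ b) (hb' : b ≤ G.reach c N H q) : ¬ G.Linked c N (c (p + a)) (c (q + b)) := by
  rw [mem_attachedIndices] at hp hq
  rcases lt_or_gt_of_ne hpq with hlt | hlt
  · exact h.not_linked hp.2 hq.2 hlt (by omega) _ a b rfl ha ha' hb hb'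
  · exact fun hl => h.not_linked hq.2 hp.2 hlt (by omega) _ b a rfl hb hb' ha ha' hl.symm

lemma not_linked_succ {p q : ℕ} (hp : p ∈ G.attachedIndices c N H)
    (hq : q ∈ G.attachedIndices c N H) (hpq : p ≠ q) :
    ¬ G.Linked c N (c (p + 1)) (c (q + 1)) :=
  h.not_linked_of_ne hp hq hpq le_rfl (h.one_le_reach_of_mem hk hp) le_rfl
    (h.one_le_reach_of_mem hk hq)

lemma not_adj_succ {p q : ℕ} (hp : p ∈ G.attachedIndices c N H)
    (hq : q ∈ G.attachedIndices c N H) : ¬ G.Adj (c (p + 1)) (c (q + 1)) := by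
  intro hadj
  by_cases hpq : p = q
  · subst hpq
    exact G.irrefl hadj
  · exact h.not_linked_succ hk hp hq hpq (Or.inl hadj)

/-- The tentacles, cut off at their reaches, and `H` are separated from each other. -/
lemma add_mul_le (hG : G.IsTough t) (ht : 0 ≤ t) :
    (t + H.card) * ((G.attachedIndices c N H).card + 1) ≤ Fintype.card V := by
  have hne : (G.attachedIndices c N H).Nonempty := Finset.card_pos.1 (by omega)
  have hHt : ∀ i ∈ G.attachedIndices c N H,
      H.card ≤ (G.tentacle c N i (G.reach c N H i)).card := by
    intro i hi
    obtain ⟨s, hs, hsN, hps⟩ := h.exists_attached_add hk hi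
    exact h.card_le_tentacle_reach (mem_attachedIndices.1 hi).2 hps hs hsN
  have key := hG.mul_card_succ_add_sum_le ht hne h.nonempty
    (B := fun i => G.tentacle c N i (G.reach c N H i)) ?_ ?_ ?_
  · have h1 : (G.attachedIndices c N H).card * (H.card : ℝ) ≤
        ∑ i ∈ G.attachedIndices c N H, ((G.tentacle c N i (G.reach c N H i)).card : ℝ) := by
      rw [← nsmul_eq_mul]
      exact Finset.card_nsmul_le_sum _ _ _ fun i hi => by exact_mod_cast hHt i hi
    linarith
  · intro i hi
    exact Finset.card_pos.1 ((Finset.card_pos.2 h.nonempty).trans_le (hHt i hi))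
  · intro i hi x hx
    obtain ⟨b, hb1, hb2, hxb⟩ := mem_tentacle.1 hx
    have hna := h.not_attached_add hk hi hb1 hb2
    have hxH : x ∉ H := by
      intro hxH
      rcases hxb with rfl | ⟨-, w, hw, hwb⟩
      · exact h.notMem_H _ hxH
      · exact hna ⟨w, h.comp_subset hxH hw, hwb.symm⟩
    refine ⟨hxH, fun y hy hxy => ?_⟩
    rcases hxb with rfl | ⟨hxX, -⟩
    · exact hna ⟨y, hy, hxy⟩
    · exact hxH (h.closed y hy x hxy.symm hxX)
  · intro i hi j hj hij x hx
    obtain ⟨a, ha1, ha2, hxa⟩ := mem_tentacle.1 hx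
    have hnl := fun b hb1 hb2 => h.not_linked_of_ne (b := b) hi hj hij ha1 ha2 hb1 hb2
    constructor
    · intro hx'
      obtain ⟨b, hb1, hb2, hxb⟩ := mem_tentacle.1 hx'
      rcases hxa with rfl | ⟨hxX, w, hw, hwa⟩
      · rcases hxb with hxb | ⟨hxX, -⟩
        · -- walking back from a common vertex, one meets the attached vertex where the shorter of
          -- the two stretches begins
          have hiA := (mem_attachedIndices.1 hi).2
          have hjA := (mem_attachedIndices.1 hj).2
          rcases Nat.lt_trichotomy a b with hab | rfl | hab
          · refine h.not_attached_add hk hj (b := b - a) (by omega) (by omega) ?_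
            rwa [Attached, ← h.apply_eq_apply_sub hxb hab.le]
          · have hcij : c i = c j := by simpa using h.apply_eq_apply_sub hxb le_rfl
            exact hij (h.inj i j (mem_attachedIndices.1 hi).1 (mem_attachedIndices.1 hj).1 hcij)
          · refine h.not_attached_add hk hi (b := a - b) (by omega) (by omega) ?_
            rwa [Attached, ← h.apply_eq_apply_sub hxb.symm hab.le]
        · exact hxX (h.mem_cycleSet _)
      · rcases hxb with rfl | ⟨-, w', hw', hwb⟩
        · exact hxX (h.mem_cycleSet _)
        · refine hnl b hb1 hb2 (Or.inr ⟨w, w', notMem_of_mem_comp hxX hw, ?_, hwa.symm, hwb⟩)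
          rwa [comp_eq_of_mem hw]
    · intro y hy hxy
      obtain ⟨b, hb1, hb2, hyb⟩ := mem_tentacle.1 hy
      refine hnl b hb1 hb2 ?_
      rcases hxa with rfl | ⟨hxX, w, hw, hwa⟩
      · rcases hyb with rfl | ⟨hyX, w', hw', hwb⟩
        · exact Or.inl hxy
        · exact Or.inr ⟨y, w', hyX, hw', hxy, hwb⟩
      · rcases hyb with rfl | ⟨hyX, w', hw', hwb⟩
        · refine Or.inr ⟨w, x, notMem_of_mem_comp hxX hw, ?_, hwa.symm, hxy⟩
          rw [comp_eq_of_mem hw]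
          exact self_mem_comp
        · refine Or.inr ⟨w, w', notMem_of_mem_comp hxX hw, ?_, hwa.symm, hwb⟩
          rwa [comp_eq_of_mem hw, ← comp_eq_of_mem (mem_comp_of_adj self_mem_comp hxy hxX hyX)]

/-! ### Crossing indices give independent sets -/

lemma notMem_attachedIndices_of_mem_cross {p j : ℕ} (hp : p ∈ G.attachedIndices c N H)
    (hj : j ∈ G.crossIndices c N H p) : j ∉ G.attachedIndices c N H :=
  fun hjI => h.not_adj_succ hk hp hjI (mem_crossIndices.1 hj).2.1

/-- Unrolling the cycle from `c j` on. -/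
lemma exists_unrolled {p j : ℕ} (hp : p ∈ G.attachedIndices c N H)
    (hj : j ∈ G.crossIndices c N H p) : ∃ p' q', j < p' ∧ p' < q' ∧ q' < j + N ∧
      G.Attached c H p' ∧ G.Attached c H q' ∧ c (p' + 1) = c (p + 1) ∧
      G.Adj (c (j + 1)) (c (p' + 1)) ∧ G.Adj (c (j + 1)) (c (q' + 1)) := by
  have hjI := h.notMem_attachedIndices_of_mem_cross hk hp hj
  obtain ⟨hjN, hadj, q, hq, hadj', hlt⟩ := mem_crossIndices.1 hj
  have hjp : p ≠ j := fun e => hjI (e ▸ hp)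
  have hunroll : ∀ i ∈ G.attachedIndices c N H,
      G.Attached c H (j + (i + N - j) % N) ∧ c (j + (i + N - j) % N + 1) = c (i + 1) := by
    intro i hi
    rw [mem_attachedIndices] at hi
    rw [offset_eq hi.1 hjN]
    split_ifs
    · exact ⟨hi.2, rfl⟩
    · exact ⟨h.attached_add_period hi.2, by rw [add_right_comm, h.add_period]⟩
  have hpos : j < j + (p + N - j) % N := by
    rw [offset_eq (mem_attachedIndices.1 hp).1 hjN]
    split_ifs <;> omega
  refine ⟨j + (p + N - j) % N, j + (q + N - j) % N, hpos, by omega, ?_, (hunroll p hp).1,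
    (hunroll q hq).1, (hunroll p hp).2, ?_, ?_⟩
  · have := Nat.mod_lt (q + N - j) (show 0 < N by omega)
    omega
  · rw [(hunroll p hp).2]; exact hadj.symm
  · rw [(hunroll q hq).2]; exact hadj'.symm

omit hk in
/-- The two reorderings of the cycle along four chords, according to which of `c q` and `c r` comes
first. -/
lemma not_crossing_four {j p q r : ℕ} (hp : G.Attached c H p) (hq : G.Attached c H q)
    (hr : ¬ G.Attached c H r) (hjp : j < p) (hpq : p < q) (hqN : q < j + N) (hpr : p < r)
    (hrN : r < j + N) (h1 : G.Adj (c j) (c r)) (h2 : G.Adj (c (r + 1)) (c (p + 1)))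
    (h3 : G.Adj (c (j + 1)) (c (q + 1))) : False := by
  rcases Nat.lt_trichotomy q r with hqr | rfl | hqr
  · exact h.not_crossing_of_lt hp hq hjp hpq hqr hrN h1 h2 h3
  · exact hr hq
  · exact h.not_crossing_of_gt hp hq hjp hpr hqr hqN h1 h2 h3

lemma not_adj_cross {p j r : ℕ} (hp : p ∈ G.attachedIndices c N H)
    (hj : j ∈ G.crossIndices c N H p) (hr : r ∈ G.crossIndices c N H p) (hjr : j < r) :
    ¬ G.Adj (c j) (c r) := by
  intro hadj
  have hjI := h.notMem_attachedIndices_of_mem_cross hk hp hj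
  have hrI := h.notMem_attachedIndices_of_mem_cross hk hp hr
  have hjN := (mem_crossIndices.1 hj).1
  have hrN := (mem_crossIndices.1 hr).1
  have hjA := not_attached_of_notMem hjN hjI
  have hrA := not_attached_of_notMem hrN hrI
  obtain ⟨p₁, q₁, hjp, hpq, hqN, hp₁, hq₁, hcp₁, hjp', hjq'⟩ := h.exists_unrolled hk hp hj
  obtain ⟨p₂, q₂, hrp, hpq₂, hqN₂, hp₂, hq₂, hcp₂, hrp', hrq'⟩ := h.exists_unrolled hk hp hr
  rcases Nat.lt_trichotomy p₁ r with hlt | rfl | hlt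
  · refine h.not_crossing_four hp₁ hq₁ hrA hjp hpq hqN hlt (by omega) hadj ?_ hjq'
    rw [hcp₁, ← hcp₂]
    exact hrp'
  · exact hrA hp₁
  · -- seen from `c r`, the vertex `c j` comes after `c (p + 1)`
    have hpp : p₁ + 1 = p₂ + 1 := h.eq_of_apply_eq (s := r + 2) (by omega) (by omega) (by omega)
      (by omega) (hcp₁.trans hcp₂.symm)
    refine h.not_crossing_four (r := j + N) hp₂ hq₂ ?_ hrp hpq₂ hqN₂ (by omega) (by omega) ?_ ?_
      hrq'
    · rwa [Attached, h.add_period]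
    · rw [h.add_period]; exact hadj.symm
    · rw [add_right_comm, h.add_period, ← hpp]; exact hjp'

/-- The vertices `c j` whose index `j` is a crossing index for `p`, the vertex `c (p + 1)`, and `H` are
separated from each other. -/
lemma cross_card_le (hG : G.IsTough t) (ht : 0 ≤ t) {p : ℕ}
    (hp : p ∈ G.attachedIndices c N H) :
    t * ((G.crossIndices c N H p).card + 2) + H.card + ((G.crossIndices c N H p).card + 1) ≤
      Fintype.card V := by
  set Z := G.crossIndices c N H p with hZ
  set J := insert (c (p + 1)) (Z.image c) with hJ
  have hZN : ∀ j ∈ Z, j < N := fun j hj => (mem_crossIndices.1 hj).1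
  have hnew : ∀ j ∈ Z, c (p + 1) ≠ c j ∧ ¬ G.Adj (c (p + 1)) (c j) := by
    intro j hj
    obtain ⟨p', q', hjp, hpq, hqN, hp', hq', hcp, hadjp, hadjq⟩ := h.exists_unrolled hk hp hj
    rw [← hcp]
    constructor
    · intro he
      rw [← h.add_period j] at he
      have := h.eq_of_apply_eq (s := j + 1) (by omega) (by omega) (by omega) (by omega) he
      omega
    · exact fun hadj => h.not_crossing hp' hq' hjp hpq hqN hadj.symm hadjq
  have hJcard : J.card = Z.card + 1 := by
    rw [hJ, Finset.card_insert_of_notMem, Finset.card_image_of_injOn]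
    · intro i hi j hj hij
      exact h.inj i j (hZN i hi) (hZN j hj) hij
    · intro hmem
      obtain ⟨j, hj, he⟩ := Finset.mem_image.1 hmem
      exact (hnew j hj).1 he.symm
  have hZZ : ∀ i ∈ Z, ∀ j ∈ Z, ¬ G.Adj (c i) (c j) := by
    intro i hi j hj hadj
    rcases Nat.lt_trichotomy i j with hij | rfl | hij
    · exact h.not_adj_cross hk hp hi hj hij hadj
    · exact G.irrefl hadj
    · exact h.not_adj_cross hk hp hj hi hij hadj.symm
  have key := hG.mul_card_succ_add_sum_le ht (T := J) ⟨_, Finset.mem_insert_self _ _⟩ h.nonempty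
    (B := fun v => {v}) (fun _ _ => Finset.singleton_nonempty _) ?_ ?_
  · simp only [Finset.card_singleton, Nat.cast_one, Finset.sum_const, nsmul_eq_mul, mul_one,
      hJcard, Nat.cast_add] at key
    linarith
  · intro v hv x hx
    obtain rfl := Finset.mem_singleton.1 hx
    rw [hJ, Finset.mem_insert, Finset.mem_image] at hv
    rcases hv with rfl | ⟨j, hj, rfl⟩
    · exact ⟨h.notMem_H _, fun y hy hxy => h.not_attached_succ hk hp ⟨y, hy, hxy⟩⟩
    · exact ⟨h.notMem_H _, fun y hy hxy => not_attached_of_notMem (hZN j hj)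
        (h.notMem_attachedIndices_of_mem_cross hk hp hj) ⟨y, hy, hxy⟩⟩
  · intro v hv w hw hvw x hx
    obtain rfl := Finset.mem_singleton.1 hx
    refine ⟨by simpa using hvw, fun y hy => ?_⟩
    obtain rfl := Finset.mem_singleton.1 hy
    rw [hJ, Finset.mem_insert, Finset.mem_image] at hv hw
    rcases hv with rfl | ⟨i, hi, rfl⟩ <;> rcases hw with rfl | ⟨j, hj, rfl⟩
    · exact absurd rfl hvw
    · exact (hnew j hj).2
    · exact fun hadj => (hnew i hi).2 hadj.symm
    · exact hZZ i hi j hj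

/-! ### Counting the edges at the successors of attached vertices -/

/-- A cycle vertex `c (j + 1)` sends one edge more to the successors of attached vertices than there
are `p` for which `j` is a crossing index. -/
lemma card_adj_cycle_le {j : ℕ} (hj : j < N) [DecidableRel G.Adj] :
    ((G.attachedIndices c N H).filter fun p => G.Adj (c (p + 1)) (c (j + 1))).card +
        (if j ∈ G.attachedIndices c N H then 1 else 0) ≤
      1 + ((G.attachedIndices c N H).filter fun p => j ∈ G.crossIndices c N H p).card := by
  set P := (G.attachedIndices c N H).filter fun p => G.Adj (c (p + 1)) (c (j + 1)) with hP
  by_cases hjI : j ∈ G.attachedIndices c N H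
  · have : P = ∅ := Finset.filter_eq_empty_iff.2 fun p hp => h.not_adj_succ hk hp hjI
    simp [this, hjI]
  · rw [if_neg hjI, add_zero]
    rcases P.eq_empty_or_nonempty with hPe | hPn
    · simp [hPe]
    · obtain ⟨q, hq, hmax⟩ := P.exists_max_image (fun p => (p + N - j) % N) hPn
      have hqI := Finset.mem_filter.1 hq
      have hsub : P.erase q ⊆
          (G.attachedIndices c N H).filter fun p => j ∈ G.crossIndices c N H p := by
        intro p hp
        obtain ⟨hpq, hpP⟩ := Finset.mem_erase.1 hp
        have hpI := Finset.mem_filter.1 hpP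
        refine Finset.mem_filter.2 ⟨hpI.1, mem_crossIndices.2
          ⟨hj, hpI.2, q, hqI.1, hqI.2, lt_of_le_of_ne (hmax p hpP) fun he => hpq ?_⟩⟩
        have hpN := (mem_attachedIndices.1 hpI.1).1
        have hqN := (mem_attachedIndices.1 hqI.1).1
        have h1 := offset_eq hpN hj
        have h2 := offset_eq hqN hj
        rw [he] at h1
        rw [h1] at h2
        split_ifs at h2 <;> omega
      have h1 := Finset.card_le_card hsub
      rw [Finset.card_erase_of_mem hq] at h1
      omega

/-- A vertex off the cycle sends at most one edge to the successors of attached vertices, and none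
if it lies in `H`. -/
lemma card_adj_off_le {y : V} (hy : y ∉ cycleSet c N) [DecidableRel G.Adj] :
    ((G.attachedIndices c N H).filter fun p => G.Adj (c (p + 1)) y).card ≤
      if y ∈ H then 0 else 1 := by
  split_ifs with hyH
  · rw [Nat.le_zero, Finset.card_eq_zero]
    exact Finset.filter_eq_empty_iff.2 fun p hp hadj => h.not_attached_succ hk hp ⟨y, hyH, hadj⟩
  · refine Finset.card_le_one.2 fun p hp q hq => ?_
    rw [Finset.mem_filter] at hp hq
    by_contra hpq
    exact h.not_linked_succ hk hp.1 hq.1 hpq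
      (Or.inr ⟨y, y, hy, self_mem_comp, hp.2, hq.2.symm⟩)

lemma sum_degree_le [DecidableRel G.Adj] :
    ∑ p ∈ G.attachedIndices c N H, G.degree (c (p + 1)) + H.card +
        (G.attachedIndices c N H).card ≤
      Fintype.card V + ∑ p ∈ G.attachedIndices c N H, (G.crossIndices c N H p).card := by
  set I := G.attachedIndices c N H with hI
  set e : V → ℕ := fun y => (I.filter fun p => G.Adj (c (p + 1)) y).card with he
  set X := cycleSet c N with hX
  have hXcard : X.card = N := by
    rw [hX, cycleSet, Finset.card_image_of_injOn, Finset.card_range]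
    intro i hi j hj hij
    exact h.inj i j (by simpa using hi) (by simpa using hj) hij
  have hdeg : ∑ p ∈ I, G.degree (c (p + 1)) = ∑ y, e y := by
    refine Eq.trans ?_ (Finset.sum_card_bipartiteAbove_eq_sum_card_bipartiteBelow
      (fun p y => G.Adj (c (p + 1)) y) (s := I) (t := Finset.univ))
    refine Finset.sum_congr rfl fun p _ => ?_
    rw [← card_neighborFinset_eq_degree]
    congr 1
    ext y
    simp [Finset.bipartiteAbove]
  have hsplit : ∑ y, e y = ∑ y ∈ X, e y + ∑ y ∈ Xᶜ, e y := (Finset.sum_add_sum_compl X e).symm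
  have hon : ∑ y ∈ X, e y = ∑ j ∈ Finset.range N, e (c (j + 1)) := by
    have hXim : X = (Finset.range N).image fun j => c (j + 1) := by
      ext y
      constructor
      · intro hy
        obtain ⟨r, hr1, hr2, rfl⟩ := h.exists_index 1 hy
        exact Finset.mem_image.2 ⟨r - 1, Finset.mem_range.2 (by omega),
          by rw [Nat.sub_add_cancel hr1]⟩
      · intro hy
        obtain ⟨j, -, rfl⟩ := Finset.mem_image.1 hy
        exact h.mem_cycleSet _
    rw [hXim, Finset.sum_image]
    intro i hi j hj hij
    have hi' := Finset.mem_range.1 hi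
    have hj' := Finset.mem_range.1 hj
    have := h.eq_of_apply_eq (s := 1) (by omega) (by omega) (by omega) (by omega) hij
    omega
  have hon' : ∑ j ∈ Finset.range N, e (c (j + 1)) + I.card ≤
      N + ∑ p ∈ I, (G.crossIndices c N H p).card := by
    have h1 : ∑ j ∈ Finset.range N, (if j ∈ I then 1 else 0) = I.card := by
      rw [Finset.sum_ite_mem, Finset.sum_const, smul_eq_mul, mul_one]
      congr 1
      exact Finset.inter_eq_right.2 fun i hi => Finset.mem_range.2 (mem_attachedIndices.1 hi).1
    have h2 : ∑ p ∈ I, (G.crossIndices c N H p).card =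
        ∑ j ∈ Finset.range N, (I.filter fun p => j ∈ G.crossIndices c N H p).card := by
      refine Eq.trans ?_ (Finset.sum_card_bipartiteAbove_eq_sum_card_bipartiteBelow
        (fun p j => j ∈ G.crossIndices c N H p) (s := I) (t := Finset.range N))
      refine Finset.sum_congr rfl fun p _ => ?_
      congr 1
      ext j
      simp only [Finset.bipartiteAbove, Finset.mem_filter, Finset.mem_range]
      exact ⟨fun hj => ⟨(mem_crossIndices.1 hj).1, hj⟩, fun hj => hj.2⟩
    have h3 := Finset.sum_le_sum fun j hj => h.card_adj_cycle_le hk (Finset.mem_range.1 hj)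
    rw [Finset.sum_add_distrib, Finset.sum_add_distrib, Finset.sum_const, Finset.card_range,
      smul_eq_mul, mul_one, h1, ← h2] at h3
    exact h3
  have hoff : ∑ y ∈ Xᶜ, e y + H.card + N ≤ Fintype.card V := by
    have hHX : H ⊆ Xᶜ := fun y hy => Finset.mem_compl.2 (h.notMem y hy)
    have h1 : ∑ y ∈ Xᶜ, e y ≤ (Xᶜ \ H).card := by
      calc ∑ y ∈ Xᶜ, e y ≤ ∑ y ∈ Xᶜ, if y ∈ H then 0 else 1 :=
            Finset.sum_le_sum fun y hy => h.card_adj_off_le hk (Finset.mem_compl.1 hy)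
        _ = (Xᶜ \ H).card := by
            rw [Finset.card_eq_sum_ones, ← Finset.filter_notMem_eq_sdiff, Finset.sum_filter]
            exact Finset.sum_congr rfl fun y _ => by by_cases hy : y ∈ H <;> simp [hy]
    have h2 := Finset.card_sdiff_add_card_eq_card hHX
    have h3 := Finset.card_add_card_compl X
    omega
  omega

omit hk in
lemma degree_add_one_le [DecidableRel G.Adj] {x : V} (hx : x ∈ H) :
    G.degree x + 1 ≤ (G.attachedIndices c N H).card + H.card := by
  have hsub : G.neighborFinset x ⊆ (G.attachedIndices c N H).image c ∪ H.erase x := by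
    intro y hy
    rw [mem_neighborFinset] at hy
    rw [Finset.mem_union]
    by_cases hyX : y ∈ cycleSet c N
    · obtain ⟨i, hi, rfl⟩ := Finset.mem_image.1 hyX
      exact Or.inl (Finset.mem_image.2
        ⟨i, mem_attachedIndices.2 ⟨Finset.mem_range.1 hi, x, hx, hy.symm⟩, rfl⟩)
    · exact Or.inr (Finset.mem_erase.2 ⟨hy.ne', h.closed x hx y hy hyX⟩)
  have h1 := (Finset.card_le_card hsub).trans (Finset.card_union_le _ _)
  rw [card_neighborFinset_eq_degree, Finset.card_erase_of_mem hx] at h1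
  have h2 : ((G.attachedIndices c N H).image c).card ≤ _ := Finset.card_image_le
  have h3 := Finset.card_pos.2 h.nonempty
  omega

end IsExtremalCycle

/-! ### The final estimate -/

/-- The bounds on the degrees at an extremal cycle contradict the degree condition: here `n`, `k`,
`m` are the numbers of vertices, of attached vertices and of vertices of `H`, while `D` is the degree
sum of the successors of the attached vertices and `Z` the total number of crossing indices. -/
lemma arithmetic_contradiction {n k m t D Z : ℝ} (ht : 1 ≤ t) (hm : 1 ≤ m) (hkt : 2 * t ≤ k)
    (hn : (t + m) * (k + 1) ≤ n) (hsum : D + m + k ≤ n + Z)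
    (hZ : (t + 1) * Z ≤ k * (n - m + 1) - 2 * k * (t + 1))
    (hD : k * (2 * n / (t + 1) + t - 2) < k * (k + m - 1) + D) : False := by
  have htp : 0 < t + 1 := by linarith
  have h1 : (t + 1) * (k * (2 * n / (t + 1) + t - 2)) = k * (2 * n + (t - 2) * (t + 1)) := by
    field_simp
    ring
  have h2 := mul_lt_mul_of_pos_left hD htp
  rw [h1] at h2
  have h3 : (t + 1) * (D + m + k) ≤ (t + 1) * (n + Z) := by gcongr
  have h4 : (t + m) * (k + 1) * (k - (t + 1)) ≤ n * (k - (t + 1)) :=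
    mul_le_mul_of_nonneg_right hn (by linarith)
  have h5 : 0 ≤ (m - 1) * (k * (k - 2 * t)) :=
    mul_nonneg (by linarith) (mul_nonneg (by linarith) (by linarith))
  have h6 : 0 ≤ (t + 1) * (k - (t + 1)) := mul_nonneg htp.le (by linarith)
  -- after inserting the least possible `n`, the coefficient of `m - 1` is `k (k - 2 t)`, and
  -- `(t + 1) (k - (t + 1)) + (t + 1)` remains
  linarith

lemma IsTough.isHamiltonian_of_one_le [DecidableRel G.Adj] {t : ℝ} (hG : G.IsTough t)
    (ht : 1 ≤ t) (hn : 3 ≤ Fintype.card V)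
    (hσ : ∀ u v, u ≠ v → ¬ G.Adj u v →
      2 * (Fintype.card V : ℝ) / (t + 1) + t - 2 < G.degree u + G.degree v) :
    G.IsHamiltonian := by
  by_contra hham
  obtain ⟨c, N, H, h⟩ :=
    exists_isExtremalCycle hn hham (hG.exists_adj (by linarith) (by omega))
  have hk := h.two_le_card hG ht
  set I := G.attachedIndices c N H with hI
  have hIne : I.Nonempty := Finset.card_pos.1 (by omega)
  have hkt : 2 * t ≤ I.card := by
    obtain ⟨p, hp⟩ := hIne
    have hna := h.not_attached_succ hk hp
    have hmod := Nat.mod_lt (p + 1) (show 0 < N by have := h.two_le; omega)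
    refine h.two_mul_le_of_not_attached hG (by linarith) hmod ?_
    rwa [Attached, h.apply_mod]
  obtain ⟨x, hx⟩ := h.nonempty
  have hm : 1 ≤ H.card := Finset.card_pos.2 h.nonempty
  have hdx := h.degree_add_one_le hx
  have hsum := h.sum_degree_le hk
  refine arithmetic_contradiction (n := Fintype.card V) (k := I.card) (m := H.card) (t := t)
    (D := ∑ p ∈ I, (G.degree (c (p + 1)) : ℝ)) (Z := ∑ p ∈ I, ((G.crossIndices c N H p).card : ℝ))
    ht (by exact_mod_cast hm) hkt ?_ (by exact_mod_cast hsum) ?_ ?_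
  · have := h.add_mul_le hk hG (by linarith)
    linarith
  · rw [Finset.mul_sum]
    calc ∑ p ∈ I, (t + 1) * ((G.crossIndices c N H p).card : ℝ)
        ≤ ∑ _p ∈ I, ((Fintype.card V : ℝ) - H.card + 1 - 2 * (t + 1)) := by
          refine Finset.sum_le_sum fun p hp => ?_
          have := h.cross_card_le hk hG (by linarith) hp
          linarith
      _ = _ := by
          rw [Finset.sum_const, nsmul_eq_mul]
          ring
  · have hlt : ∀ p ∈ I, 2 * (Fintype.card V : ℝ) / (t + 1) + t - 2 <
        (I.card + H.card - 1 : ℝ) + G.degree (c (p + 1)) := by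
      intro p hp
      have h1 := hσ x (c (p + 1)) (fun e => h.notMem_H (p + 1) (e ▸ hx))
        (fun hadj => h.not_attached_succ hk hp ⟨x, hx, hadj.symm⟩)
      have h2 : (G.degree x : ℝ) + 1 ≤ I.card + H.card := by exact_mod_cast hdx
      linarith
    have := Finset.sum_lt_sum_of_nonempty hIne hlt
    rwa [Finset.sum_add_distrib, Finset.sum_const, Finset.sum_const, nsmul_eq_mul,
      nsmul_eq_mul] at this

end

end SimpleGraph

theorem theorem1 {V : Type*} [Fintype V] [DecidableEq V] (G : SimpleGraph V)
    [DecidableRel G.Adj] (t : ℝ) (ht : 0 ≤ t) (hn : 3 ≤ Fintype.card V) (hG : G.IsTough t)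
    (hσ : ((2 * (Fintype.card V : ℝ) / (t + 1) + t - 2 : ℝ) : EReal) < G.sigmaTwo) :
    G.IsHamiltonian := by
  have hdeg : ∀ u v, u ≠ v → ¬ G.Adj u v →
      2 * (Fintype.card V : ℝ) / (t + 1) + t - 2 < G.degree u + G.degree v :=
    fun u v huv hadj => SimpleGraph.lt_degree_add_of_lt_sigmaTwo hσ huv hadj
  rcases le_or_gt 1 t with h1 | h1
  · exact hG.isHamiltonian_of_one_le h1 hn hdeg
  · -- for `t < 1` the bound is at least its value `n - 1` at `1`
    have hn' : (3 : ℝ) ≤ Fintype.card V := by exact_mod_cast hn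
    have hbound : (Fintype.card V : ℝ) - 1 ≤ 2 * (Fintype.card V : ℝ) / (t + 1) + t - 2 := by
      have htp : 0 < t + 1 := by linarith
      have h2 : (Fintype.card V : ℝ) + 1 - t ≤ 2 * (Fintype.card V : ℝ) / (t + 1) := by
        rw [le_div_iff₀ htp]
        nlinarith
      linarith
    have hore : ∀ u v, u ≠ v → ¬ G.Adj u v →
        (Fintype.card V : ℝ) - 1 < G.degree u + G.degree v :=
      fun u v huv hadj => hbound.trans_lt (hdeg u v huv hadj)
    refine (SimpleGraph.isTough_one_of_card_le_degree_add ?_).isHamiltonian_of_one_le le_rfl hn ?_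
    · intro u v huv hadj
      have := hore u v huv hadj
      have h3 : (Fintype.card V : ℝ) < (G.degree u + G.degree v + 1 : ℕ) := by
        push_cast
        linarith
      have h4 : Fintype.card V < G.degree u + G.degree v + 1 := by exact_mod_cast h3
      omega
    · intro u v huv hadj
      have := hore u v huv hadj
      linarith
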